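/- **Conventions.** $\mathbf C\{z_1\}$ is the ring of convergent power series. The Newton polygon $N(P)$ of $P=\sum a_{ij}z_1^iz_2^j\in\mathbf C\{z_1\}[z_2]$ is the convex hull in $\mathbf R^2$ of $\bigcup_{a_{ij}\ne0}\big((j,i)+\mathbf N^2\big)$; the exponent of $z_2$ is on the horizontal axis and the exponent of $z_1$ on the vertical axis. More generally a Newton polygon is the convex hull of $\bigcup_{A\in S}(A+\mathbf N^2)$ for a nonempty $S\subset\mathbf N^2$; it has finite area if its complement in the positive quadrant has finite area. The sum of two Newton polygons is the convex hull of the set of sums $p_1+p_2$ of their points. For positive integers $\ell,h$ the elementary polygon $E(\ell,h)$ of length $\ell$ and height $h$ is the convex hull of $\big((\ell,0)+\mathbf N^2\big)\cup\big((0,h)+\mathbf N^2\big)$. Every Newton polygon of finite area is a finite sum of elementary polygons (the empty sum being the positive quadrant). Put $$E(\ell,h)*E(\ell',h')=E\big(\ell\ell',\min(\ell h',\ell'h)\big),\qquad \Big(\sum_iE_i\Big)*\Big(\sum_jE'_j\Big)=\sum_{i,j}E_i*E'_j ;$$ this does not depend on the decompositions. For a compact edge $\gamma$ of $N(P)$ let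 $P_\gamma$ be the sum of the terms of $P$ whose exponents lie on $\gamma$. **Proposition.** Let $N_1,N_2$ be Newton polygons of finite area. (1) Let $P_1,P_2\in\mathbf C\{z_1\}[z_2]$ be monic in $z_2$ with $N(P_i)=N_i$ $(i=1,2)$, such that $P_1(0,z_2)$ and $P_2(0,z_2)$ have no common zero other than $z_2=0$ (which holds automatically if one of the $P_i$ is a Weierstrass polynomial, i.e. $P_i(0,z_2)$ is a power of $z_2$). Suppose that for every compact edge $\gamma_1$ of $N_1$ and every compact edge $\gamma_2$ of $N_2$ the polynomials $P_{1,\gamma_1}$ and $P_{2,\gamma_2}$ have no common zero $(z_1,z_2)$ with $z_1z_2\neq0$ in some neighbourhood of the origin. Then $$N\big(\mathrm{Res}_U(P_1(z_2+U),P_2(U))\big)=N_1*N_2 .$$ (2) The condition on the edge polynomials in (1) is a non-empty Zariski-open condition on the coefficients on the edges: there is a nonzero polynomial $F$ over $\mathbf C$, whose variables are indexed by the disjoint union of the sets of lattice points on the compact edges of $N_1$ and of $N_2$, such that for all $P_1,P_2\in\mathbf C\{z_1\}[z_2]$ with $N(P_i)=N_i$ the condition holds if and only if $F$ does not vanish at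 the corresponding coefficients of $P_1,P_2$. -/

import Mathlib

open scoped Polynomial Topology

namespace NewtonProduct

/-! ### The ring of convergent power series in one variable -/

/-- A formal power series over `ℂ` converges near `0` if it converges absolutely on a disk of
positive radius. -/
def IsConvergent (f : PowerSeries ℂ) : Prop :=
  ∃ r : ℝ, 0 < r ∧ Summable fun n : ℕ => ‖PowerSeries.coeff n f * (r : ℂ) ^ n‖

theorem isConvergent_polynomial (p : ℂ[X]) : IsConvergent (p : PowerSeries ℂ) := by
  refine ⟨1, one_pos, summable_of_ne_finset_zero (s := p.support) fun n hn => ?_⟩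
  simp [Polynomial.notMem_support_iff.mp hn]

theorem IsConvergent.mono {f : PowerSeries ℂ} {r s : ℝ} (hs : 0 < s) (hsr : s ≤ r)
    (h : Summable fun n : ℕ => ‖PowerSeries.coeff n f * (r : ℂ) ^ n‖) :
    Summable fun n : ℕ => ‖PowerSeries.coeff n f * (s : ℂ) ^ n‖ := by
  refine Summable.of_nonneg_of_le (fun n => norm_nonneg _) (fun n => ?_) h
  rw [norm_mul, norm_mul, norm_pow, norm_pow, Complex.norm_real, Complex.norm_real,
    Real.norm_of_nonneg hs.le, Real.norm_of_nonneg (hs.le.trans hsr)]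
  gcongr

/-- The ring `ℂ{z₁}` of convergent power series, as a subring of `ℂ⟦z₁⟧`. -/
def convergentSeries : Subring (PowerSeries ℂ) where
  carrier := {f | IsConvergent f}
  zero_mem' := by simpa using isConvergent_polynomial 0
  one_mem' := by simpa using isConvergent_polynomial 1
  add_mem' := by
    rintro f g ⟨r, hr, hf⟩ ⟨s, hs, hg⟩
    have hf' := IsConvergent.mono (lt_min hr hs) (min_le_left r s) hf
    have hg' := IsConvergent.mono (lt_min hr hs) (min_le_right r s) hg
    refine ⟨min r s, lt_min hr hs, Summable.of_nonneg_of_le (fun n => norm_nonneg _)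
      (fun n => ?_) (hf'.add hg')⟩
    rw [map_add, add_mul]
    exact norm_add_le _ _
  neg_mem' := by
    rintro f ⟨r, hr, hf⟩
    exact ⟨r, hr, by simpa using hf⟩
  mul_mem' := by
    rintro f g ⟨r, hr, hf⟩ ⟨s, hs, hg⟩
    have hf' := IsConvergent.mono (lt_min hr hs) (min_le_left r s) hf
    have hg' := IsConvergent.mono (lt_min hr hs) (min_le_right r s) hg
    refine ⟨min r s, lt_min hr hs,
      (summable_norm_sum_mul_antidiagonal_of_summable_norm hf' hg').congr fun n => ?_⟩
    rw [PowerSeries.coeff_mul, Finset.sum_mul]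
    congr 1
    refine Finset.sum_congr rfl fun k hk => ?_
    rw [← Finset.HasAntidiagonal.mem_antidiagonal.mp hk, pow_add]
    ring

/-- `ℂ{z₁}`. -/
abbrev Cz : Type := convergentSeries

/-- The coefficient of `z₁ ^ i * z₂ ^ j` in an element `P` of `ℂ{z₁}[z₂]`. -/
noncomputable def coeffAt (P : Cz[X]) (j i : ℕ) : ℂ :=
  PowerSeries.coeff i (P.coeff j : PowerSeries ℂ)

/-- The polynomial `P(0, z₂)`. -/
noncomputable def atZero (P : Cz[X]) : ℂ[X] :=
  P.map ((PowerSeries.constantCoeff (R := ℂ)).comp convergentSeries.subtype)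

/-! ### Newton polygons

Newton polygons are drawn in `ℝ × ℝ`; the first coordinate is horizontal, the second vertical.
They are represented by the convex region that they bound. -/

/-- A lattice point, seen in the plane. -/
def toPlane (a : ℕ × ℕ) : ℝ × ℝ := (a.1, a.2)

/-- The convex hull of `⋃ (a + ℕ²)` for `a ∈ S`. -/
def hullOf (S : Set (ℕ × ℕ)) : Set (ℝ × ℝ) :=
  convexHull ℝ {p | ∃ a ∈ S, ∃ b : ℕ × ℕ, p = toPlane (a + b)}

/-- Newton polygons: the sets that arise from supports of nonzero power series. -/
def IsNewtonPolygon (N : Set (ℝ × ℝ)) : Prop :=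
  ∃ S : Set (ℕ × ℕ), S.Nonempty ∧ N = hullOf S

/-- The complement of the polygon in the positive quadrant has finite area. -/
def HasFiniteArea (N : Set (ℝ × ℝ)) : Prop :=
  MeasureTheory.volume ({p : ℝ × ℝ | 0 ≤ p.1 ∧ 0 ≤ p.2} \ N) < ⊤

/-- The Newton polygon of `P ∈ ℂ{z₁}[z₂]`, with the exponent of `z₂` on the horizontal axis and
the exponent of `z₁` on the vertical axis: the monomial `z₁ ^ i * z₂ ^ j` sits at `(j, i)`. -/
def newtonPolygon (P : Cz[X]) : Set (ℝ × ℝ) :=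
  hullOf {a | coeffAt P a.1 a.2 ≠ 0}

/-- The elementary polygon of length `l` (on the horizontal axis) and height `h`. -/
def elementary (l h : ℕ) : Set (ℝ × ℝ) := hullOf {(l, 0), (0, h)}

/-- The sum of two Newton polygons. -/
def polygonAdd (M N : Set (ℝ × ℝ)) : Set (ℝ × ℝ) :=
  convexHull ℝ {p | ∃ x ∈ M, ∃ y ∈ N, p = x + y}

/-- The sum of the elementary polygons with the (length, height) pairs listed in `D`. The empty
sum is the positive quadrant, which is the neutral element of the addition of polygons. -/
def elementarySum (D : List (ℕ × ℕ)) : Set (ℝ × ℝ) :=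
  D.foldr (fun d N => polygonAdd (elementary d.1 d.2) N) (hullOf {(0, 0)})

/-- `D` lists the lengths and heights in a decomposition of `N` as a sum of elementary polygons. -/
def IsDecomposition (N : Set (ℝ × ℝ)) (D : List (ℕ × ℕ)) : Prop :=
  (∀ d ∈ D, 0 < d.1 ∧ 0 < d.2) ∧ N = elementarySum D

open Classical in
/-- A decomposition of `N` as a sum of elementary polygons; every Newton polygon of finite area
has one. -/
noncomputable def decomposition (N : Set (ℝ × ℝ)) : List (ℕ × ℕ) :=
  if h : ∃ D, IsDecomposition N D then h.choose else []

/-- The (length, height) pair of the product of two elementary polygons. -/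
def elementaryMul (d e : ℕ × ℕ) : ℕ × ℕ := (d.1 * e.1, min (d.1 * e.2) (e.1 * d.2))

/-- The product `M * N` of two Newton polygons of finite area: the sum of the products
`Mᵢ * Nⱼ` for decompositions `M = ∑ Mᵢ`, `N = ∑ Nⱼ` into elementary polygons. The result does not
depend on the decompositions. -/
noncomputable def polygonMul (M N : Set (ℝ × ℝ)) : Set (ℝ × ℝ) :=
  elementarySum
    ((decomposition M ×ˢ decomposition N).map fun de => elementaryMul de.1 de.2)

/-! ### Compact edges and edge polynomials -/

/-- `γ` is a compact edge of `N`: the face on which a linear form with positive coefficients is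
minimal, when this face is not a single point. -/
def IsCompactEdge (N γ : Set (ℝ × ℝ)) : Prop :=
  γ.Nontrivial ∧ ∃ u v : ℝ, 0 < u ∧ 0 < v ∧
    γ = {p ∈ N | ∀ q ∈ N, u * p.1 + v * p.2 ≤ u * q.1 + v * q.2}

/-- The sum of the terms of `P` whose exponents lie on `γ`, as an element of `ℂ[z₁][z₂]`. -/
noncomputable def edgePolynomial (P : Cz[X]) (γ : Set (ℝ × ℝ)) : ℂ[X][X] :=
  ∑ᶠ a ∈ {a : ℕ × ℕ | toPlane a ∈ γ},
    Polynomial.monomial a.1 (Polynomial.monomial a.2 (coeffAt P a.1 a.2))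

/-- For every compact edge `γ₁` of `N₁` and `γ₂` of `N₂`, the edge polynomials of `P₁` and `P₂`
have no common zero off the coordinate axes in some neighbourhood of the origin. -/
def EdgesInGeneralPosition (N₁ N₂ : Set (ℝ × ℝ)) (P₁ P₂ : Cz[X]) : Prop :=
  ∀ γ₁ γ₂ : Set (ℝ × ℝ), IsCompactEdge N₁ γ₁ → IsCompactEdge N₂ γ₂ →
    ∀ᶠ z : ℂ × ℂ in 𝓝 0, z.1 ≠ 0 → z.2 ≠ 0 →
      ¬ ((edgePolynomial P₁ γ₁).evalEval z.1 z.2 = 0 ∧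
        (edgePolynomial P₂ γ₂).evalEval z.1 z.2 = 0)

/-- The lattice points on the compact edges of `N`. -/
def EdgePoint (N : Set (ℝ × ℝ)) : Type :=
  {a : ℕ × ℕ // ∃ γ, IsCompactEdge N γ ∧ toPlane a ∈ γ}

/-- The coefficients of `P₁` and `P₂` at the lattice points of the compact edges. -/
noncomputable def edgeCoeffs (N₁ N₂ : Set (ℝ × ℝ)) (P₁ P₂ : Cz[X]) :
    EdgePoint N₁ ⊕ EdgePoint N₂ → ℂ :=
  Sum.elim (fun a => coeffAt P₁ a.1.1 a.1.2) (fun a => coeffAt P₂ a.1.1 a.1.2)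

/-! ### The resultant -/

/-- `Res_U (P₁(T + U), P₂(U))`, an element of `V[T]`; the outer variable of `V[T][U]` is `U`. -/
noncomputable def resultantPoly {V : Type*} [CommRing V] (P₁ P₂ : V[X]) : V[X] :=
  Polynomial.resultant
    ((P₁.map Polynomial.C).comp (Polynomial.C Polynomial.X + Polynomial.X))
    (P₂.map Polynomial.C)

end NewtonProduct

open scoped Polynomial Topology

namespace NewtonProduct

/-! ### An algebraically closed valued field containing the power series -/

/-! Embed $\mathbf C\{z_1\}$ in an algebraically closed field with a nonarchimedean absolute value
`v` extending the $z_1$-adic one, and put $\rho=|z_1|<1$. For $t>0$, the minimum of $tx+y$ over the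
exponents of $P$ is $\log_\rho$ of the Gauss norm of $P$ at radius $\rho^t$ (`isLeast_gaussNorm`).
Gauss norms are multiplicative, so for monic $P=\prod(z_2-\alpha)$ this minimum is
$\sum_\alpha\min(t,\mathrm{ord}\,\alpha)$. These minima determine the Newton polygon
(`hullOf_eq_of_isLeast`).

The resultant is, up to sign, $\prod(z_2-(\alpha-\beta))$ over pairs of roots
(`resultantPoly_eq_prod`), so part (1) reduces to $|\alpha-\beta|=\max(|\alpha|,|\beta|)$
(`map_sub_eq_max`). Only the case of equal orders $r$ needs an argument. If $r=q/p>0$, take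
$\zeta^p=z_1$ and write $\alpha=\xi\zeta^q$, $\beta=\eta\zeta^q$ with $|\xi|=|\eta|=1$. Modulo
elements of absolute value less than 1, $\xi$ and $\eta$ are roots of the polynomials of two
parallel edges, which share no nonzero root; hence $|\xi-\eta|=1$. For $r=0$ the polynomials
$P_i(0,z_2)$ play the same role. The minimum for the resultant is thus
$\sum\min(t,\mathrm{ord}\,\alpha,\mathrm{ord}\,\beta)$. As $E(\ell,h)$ has minimum $\min(t\ell,h)$,
this is also the minimum for $N_1*N_2$ (`sum_elementaryMul`).

For part (2), edge polynomials are quasi-homogeneous. For parallel edges, a common zero off the axes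
is a common nonzero root of two one-variable polynomials, detected by a resultant
(`eventually_not_common_zero_iff`). For non-parallel edges the zeros have incompatible growth near
the origin, and the condition always holds. The product over the finitely many pairs of edges is
$F$. -/

theorem exists_absoluteValue_algebraicClosure (K : Type) [NontriviallyNormedField K]
    [IsUltrametricDist K] [CompleteSpace K] : ∃ v : AbsoluteValue (AlgebraicClosure K) ℝ,
      IsNonarchimedean v ∧ ∀ x : K, v (algebraMap K _ x) = ‖x‖ := by
  let w := spectralMulAlgNorm K (AlgebraicClosure K)
  refine ⟨⟨⟨w, map_mul w⟩, apply_nonneg w, fun x => map_eq_zero_iff_eq_zero w,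
    map_add_le_add w⟩, isNonarchimedean_spectralNorm, fun x => spectralNorm_extends x⟩

/-- Laurent series are complete for the $X$-adic absolute value, which therefore extends to the
algebraic closure; power series form the unit ball. -/
theorem exists_isAlgClosed_absoluteValue : ∃ (L : Type) (_ : Field L) (_ : IsAlgClosed L)
    (φ : PowerSeries ℂ →+* L) (v : AbsoluteValue L ℝ), IsNonarchimedean v ∧
      (∀ f, v (φ f) ≤ 1) ∧ 0 < v (φ PowerSeries.X) ∧ v (φ PowerSeries.X) < 1 := by
  let V : Valued (LaurentSeries ℂ) (WithZero (Multiplicative ℤ)) := LaurentSeries.valued ℂ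
  have hX : V.v ((PowerSeries.X : PowerSeries ℂ) : LaurentSeries ℂ) = WithZero.exp (-1 : ℤ) := by
    simpa using LaurentSeries.valuation_X_pow ℂ 1
  have hs : Function.Surjective V.v := LaurentSeries.valuation_surjective ℂ
  have : V.v.IsNontrivial := by
    refine ⟨⟨((PowerSeries.X : PowerSeries ℂ) : LaurentSeries ℂ), ?_, ?_⟩⟩
    · rw [hX]; simp
    · rw [hX, ← WithZero.exp_zero]
      exact fun h => by simpa using WithZero.exp_injective h
  have : V.v.IsRankOneDiscrete := inferInstance
  -- The base 2 is arbitrary: only $0<|X|<1$ is used later.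
  let R : V.v.RankOne := Valuation.IsRankOneDiscrete.rankOne V.v (e := 2) (by norm_num)
  let NF : NontriviallyNormedField (LaurentSeries ℂ) :=
    Valued.toNontriviallyNormedField (LaurentSeries ℂ) (WithZero (Multiplicative ℤ))
  have hU : IsUltrametricDist (LaurentSeries ℂ) :=
    Valued.instIsUltrametricDist (LaurentSeries ℂ) (WithZero (Multiplicative ℤ))
  have hC : CompleteSpace (LaurentSeries ℂ) := LaurentSeries.instLaurentSeriesComplete
  obtain ⟨v, hv, h⟩ := exists_absoluteValue_algebraicClosure (LaurentSeries ℂ)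
  refine ⟨AlgebraicClosure (LaurentSeries ℂ), inferInstance, inferInstance,
    (algebraMap (LaurentSeries ℂ) _).comp (HahnSeries.ofPowerSeries ℤ ℂ), v, hv, fun f => ?_,
    ?_, ?_⟩
  · rw [RingHom.comp_apply, h]
    refine (Valued.toNormedField.norm_le_one_iff
      (Γ₀ := WithZero (Multiplicative ℤ)) (L := LaurentSeries ℂ)).2 ?_
    exact (LaurentSeries.val_le_one_iff_eq_coe ℂ _).2 ⟨f, rfl⟩
  · refine v.pos ?_
    rw [RingHom.comp_apply, map_ne_zero]
    intro h0
    rw [h0, map_zero] at hX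
    exact WithZero.exp_ne_zero hX.symm
  · rw [RingHom.comp_apply, h]
    refine (Valued.toNormedField.norm_lt_one_iff
      (Γ₀ := WithZero (Multiplicative ℤ)) (L := LaurentSeries ℂ)).2 ?_
    rw [hX, ← WithZero.exp_zero, WithZero.exp_lt_exp]
    norm_num

/-! ### Convex geometry of Newton polygons -/

/-- The linear form `t * x + y` on the plane. -/
noncomputable def weight (t : ℝ) : (ℝ × ℝ) →ₗ[ℝ] ℝ :=
  t • LinearMap.fst ℝ ℝ ℝ + LinearMap.snd ℝ ℝ ℝ

@[simp]
theorem weight_apply (t : ℝ) (p : ℝ × ℝ) : weight t p = t * p.1 + p.2 := by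
  simp [weight]

open scoped Pointwise in
theorem hullOf_eq (S : Set (ℕ × ℕ)) : hullOf S = convexHull ℝ (toPlane '' S + Set.range toPlane) := by
  unfold hullOf
  congr 1
  ext p
  simp only [Set.mem_ofPred_eq, Set.mem_add, Set.mem_image, Set.mem_range]
  constructor
  · rintro ⟨a, ha, b, rfl⟩
    exact ⟨_, ⟨a, ha, rfl⟩, _, ⟨b, rfl⟩, by simp [toPlane]⟩
  · rintro ⟨_, ⟨a, ha, rfl⟩, _, ⟨b, rfl⟩, rfl⟩
    exact ⟨a, ha, b, by simp [toPlane]⟩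

theorem toPlane_mem_hullOf {S : Set (ℕ × ℕ)} {a : ℕ × ℕ} (ha : a ∈ S) : toPlane a ∈ hullOf S :=
  subset_convexHull ℝ _ ⟨a, ha, 0, by simp⟩

theorem convexHull_natCast : convexHull ℝ (Set.range ((↑) : ℕ → ℝ)) = Set.Ici 0 := by
  refine subset_antisymm (convexHull_min ?_ (convex_Ici 0)) fun x hx => ?_
  · rintro _ ⟨n, rfl⟩
    exact Nat.cast_nonneg (α := ℝ) n
  · obtain ⟨n, hn⟩ := exists_nat_ge x
    refine segment_subset_convexHull (𝕜 := ℝ) (Set.mem_range.2 ⟨0, Nat.cast_zero⟩)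
      (Set.mem_range_self n) ?_
    rw [segment_eq_Icc (Nat.cast_nonneg n)]
    exact ⟨hx, hn⟩

theorem convexHull_range_toPlane :
    convexHull ℝ (Set.range toPlane) = Set.Ici (0 : ℝ) ×ˢ Set.Ici (0 : ℝ) := by
  have : Set.range toPlane = Set.range ((↑) : ℕ → ℝ) ×ˢ Set.range ((↑) : ℕ → ℝ) := by
    ext ⟨x, y⟩
    simp [toPlane]
  rw [this, convexHull_prod, convexHull_natCast]

open scoped Pointwise in
theorem hullOf_eq_add (S : Set (ℕ × ℕ)) :
    hullOf S = convexHull ℝ (toPlane '' S) + Set.Ici (0 : ℝ) ×ˢ Set.Ici (0 : ℝ) := by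
  rw [hullOf_eq, convexHull_add, convexHull_range_toPlane]

theorem hullOf_eq_of_subset_of_forall_le {S T : Set (ℕ × ℕ)} (hTS : T ⊆ S)
    (h : ∀ a ∈ S, ∃ b ∈ T, b ≤ a) : hullOf T = hullOf S := by
  unfold hullOf
  congr 1
  ext p
  constructor
  · rintro ⟨a, ha, b, rfl⟩
    exact ⟨a, hTS ha, b, rfl⟩
  · rintro ⟨a, ha, b, rfl⟩
    obtain ⟨c, hc, hca⟩ := h a ha
    exact ⟨c, hc, (a - c) + b, by rw [← add_assoc, add_tsub_cancel_of_le hca]⟩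

/-- Dickson's lemma: the minimal elements of a subset of $\mathbf N^2$ form a finite antichain, and
they generate the same upward-closed set. -/
theorem exists_finite_hullOf_eq (S : Set (ℕ × ℕ)) :
    ∃ T : Set (ℕ × ℕ), T.Finite ∧ hullOf T = hullOf S := by
  refine ⟨{a | Minimal (· ∈ S) a}, ?_, ?_⟩
  · exact WellQuasiOrderedLE.finite_of_isAntichain (setOfPred_minimal_antichain _)
  · refine hullOf_eq_of_subset_of_forall_le (fun a ha => ha.prop) fun a ha => ?_
    obtain ⟨b, hb, hb'⟩ := exists_minimal_le_of_wellFoundedLT (· ∈ S) a ha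
    exact ⟨b, hb', hb⟩

/-- A polytope plus the closed quadrant is compact plus closed. Closedness is what permits strict
separation in `mem_hullOf_of_forall`. -/
theorem isClosed_hullOf (S : Set (ℕ × ℕ)) : IsClosed (hullOf S) := by
  obtain ⟨T, hT, hTS⟩ := exists_finite_hullOf_eq S
  rw [← hTS, hullOf_eq_add]
  exact (isClosed_Ici.prod isClosed_Ici).add_left_of_isCompact
    ((hT.image _).isCompact_convexHull ℝ)

theorem le_weight_of_mem_hullOf {S : Set (ℕ × ℕ)} {t m : ℝ} (ht : 0 ≤ t)
    (h : ∀ a ∈ S, m ≤ weight t (toPlane a)) {p : ℝ × ℝ} (hp : p ∈ hullOf S) :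
    m ≤ weight t p := by
  have hc : Convex ℝ {p | m ≤ weight t p} := convex_halfSpace_ge (weight t).isLinear m
  refine convexHull_min (t := {p | m ≤ weight t p}) ?_ hc hp
  rintro _ ⟨a, ha, b, rfl⟩
  have := h a ha
  simp only [weight_apply, toPlane, Prod.fst_add, Prod.snd_add, Nat.cast_add,
    Set.mem_ofPred_eq] at this ⊢
  have : 0 ≤ t * (b.1 : ℝ) := by positivity
  have : (0 : ℝ) ≤ b.2 := by positivity
  linarith

theorem isLeast_weight_hullOf {S : Set (ℕ × ℕ)} {t m : ℝ} (ht : 0 ≤ t)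
    (h : IsLeast ((fun a => weight t (toPlane a)) '' S) m) :
    IsLeast (weight t '' hullOf S) m := by
  obtain ⟨⟨a, ha, rfl⟩, hm⟩ := h
  refine ⟨⟨_, toPlane_mem_hullOf ha, rfl⟩, ?_⟩
  rintro _ ⟨p, hp, rfl⟩
  exact le_weight_of_mem_hullOf ht (fun b hb => hm ⟨b, hb, rfl⟩) hp

theorem eq_of_isLeast_of_hullOf_eq {S T : Set (ℕ × ℕ)} {t m n : ℝ} (ht : 0 ≤ t)
    (hS : IsLeast ((fun a => weight t (toPlane a)) '' S) m)
    (hT : IsLeast ((fun a => weight t (toPlane a)) '' T) n) (h : hullOf S = hullOf T) : m = n := by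
  have := isLeast_weight_hullOf ht hT
  rw [← h] at this
  exact (isLeast_weight_hullOf ht hS).unique this

/-- A lattice point belongs to a Newton polygon as soon as no linear form with positive
coefficients separates it. -/
theorem mem_hullOf_of_forall {T : Set (ℕ × ℕ)} (hT : T.Nonempty) {p : ℝ × ℝ}
    (h : ∀ t m : ℝ, 0 < t → (∀ b ∈ T, m ≤ weight t (toPlane b)) → m ≤ weight t p) :
    p ∈ hullOf T := by
  by_contra hp
  obtain ⟨f, s, hfp, hf⟩ := geometric_hahn_banach_point_closed (convex_convexHull ℝ _)
    (isClosed_hullOf T) hp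
  set u := f (1, 0) with hu
  set v := f (0, 1) with hv
  have hfe : ∀ q : ℝ × ℝ, f q = u * q.1 + v * q.2 := fun q => by
    have : q = q.1 • ((1 : ℝ), (0 : ℝ)) + q.2 • ((0 : ℝ), (1 : ℝ)) := by ext <;> simp
    conv_lhs => rw [this]
    rw [map_add, map_smul, map_smul, smul_eq_mul, smul_eq_mul]
    ring
  obtain ⟨b₀, hb₀⟩ := hT
  have key : ∀ (b : ℕ × ℕ), s < u * (b₀.1 + b.1) + v * (b₀.2 + b.2) := fun b => by
    have := hf (toPlane (b₀ + b)) (subset_convexHull ℝ _ ⟨b₀, hb₀, b, rfl⟩)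
    rw [hfe] at this
    simpa [toPlane] using this
  -- The hull contains all translates of $b_0$ by $(n,0)$, on which a form with $u<0$ would be
  -- unbounded below.
  have hu0 : 0 ≤ u := by
    by_contra! hlt
    obtain ⟨n, hn⟩ := exists_nat_gt ((u * b₀.1 + v * b₀.2 - s) / -u)
    rw [div_lt_iff₀ (by linarith)] at hn
    have := key (n, 0)
    simp only [Nat.cast_zero] at this
    nlinarith
  have hv0 : 0 ≤ v := by
    by_contra! hlt
    obtain ⟨n, hn⟩ := exists_nat_gt ((u * b₀.1 + v * b₀.2 - s) / -v)
    rw [div_lt_iff₀ (by linarith)] at hn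
    have := key (0, n)
    simp only [Nat.cast_zero] at this
    nlinarith
  -- The separating form may have a zero coefficient. Adding a small $\varepsilon$ to both makes
  -- them positive and still separates $p$; dividing by $v+\varepsilon$ then brings the form to the
  -- shape `weight`.
  obtain ⟨ε, hε, hεp⟩ : ∃ ε : ℝ, 0 < ε ∧ ε * (|p.1| + |p.2|) < s - f p := by
    refine ⟨(s - f p) / (|p.1| + |p.2| + 1), div_pos (by linarith) (by positivity), ?_⟩
    rw [div_mul_eq_mul_div, div_lt_iff₀ (by positivity)]
    nlinarith [abs_nonneg p.1, abs_nonneg p.2]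
  have hpos : 0 < v + ε := by linarith
  have := h ((u + ε) / (v + ε)) (s / (v + ε)) (div_pos (by linarith) hpos) fun b hb => by
    have h1 := hf _ (toPlane_mem_hullOf hb)
    rw [hfe] at h1
    rw [weight_apply, div_le_iff₀ hpos]
    have h2 : (u + ε) / (v + ε) * (toPlane b).1 * (v + ε) = (u + ε) * (toPlane b).1 := by
      field_simp
    rw [add_mul, h2]
    have h3 : 0 ≤ (toPlane b).1 := Nat.cast_nonneg _
    have h4 : 0 ≤ (toPlane b).2 := Nat.cast_nonneg _
    nlinarith [mul_nonneg hε.le h3, mul_nonneg hε.le h4]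
  rw [weight_apply, div_le_iff₀ hpos] at this
  have h2 : (u + ε) / (v + ε) * p.1 * (v + ε) = (u + ε) * p.1 := by
    field_simp
  rw [add_mul, h2] at this
  rw [hfe] at hεp
  nlinarith [mul_le_mul_of_nonneg_left (le_abs_self p.1) hε.le,
    mul_le_mul_of_nonneg_left (le_abs_self p.2) hε.le]

/-- A closed convex set that is stable under adding the quadrant is the intersection of the
half-planes containing it, so its support function determines it; positive slopes suffice. -/
theorem hullOf_eq_of_isLeast {S T : Set (ℕ × ℕ)} (f : ℝ → ℝ)
    (hS : ∀ t, 0 < t → IsLeast ((fun a => weight t (toPlane a)) '' S) (f t))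
    (hT : ∀ t, 0 < t → IsLeast ((fun a => weight t (toPlane a)) '' T) (f t)) :
    hullOf S = hullOf T := by
  have main : ∀ {S T : Set (ℕ × ℕ)},
      (∀ t, 0 < t → IsLeast ((fun a => weight t (toPlane a)) '' S) (f t)) →
      (∀ t, 0 < t → IsLeast ((fun a => weight t (toPlane a)) '' T) (f t)) →
      hullOf S ⊆ hullOf T := by
    intro S T hS hT p hp
    refine mem_hullOf_of_forall (Set.image_nonempty.1 (hT 1 one_pos).nonempty)
      fun t m ht hm => ?_
    obtain ⟨b, hb, hbt⟩ := (hT t ht).1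
    refine (hm b hb).trans ?_
    rw [show weight t (toPlane b) = f t from hbt]
    exact le_weight_of_mem_hullOf ht.le (fun a ha => (hS t ht).2 ⟨a, ha, rfl⟩) hp
  exact subset_antisymm (main hS hT) (main hT hS)

open scoped Pointwise in
theorem polygonAdd_hullOf (S T : Set (ℕ × ℕ)) :
    polygonAdd (hullOf S) (hullOf T) = hullOf (S + T) := by
  have h1 : {p | ∃ x ∈ hullOf S, ∃ y ∈ hullOf T, p = x + y} = hullOf S + hullOf T := by
    ext p
    simp only [Set.mem_ofPred_eq, Set.mem_add, eq_comm]
  have h2 : toPlane '' (S + T) = toPlane '' S + toPlane '' T :=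
    Set.image_image2_distrib (fun a b => by simp [toPlane])
  have h3 : Set.range toPlane = Set.range toPlane + Set.range toPlane := by
    ext p
    simp only [Set.mem_add, Set.mem_range]
    constructor
    · rintro ⟨a, rfl⟩
      exact ⟨_, ⟨a, rfl⟩, _, ⟨0, rfl⟩, by simp [toPlane]⟩
    · rintro ⟨_, ⟨a, rfl⟩, _, ⟨b, rfl⟩, rfl⟩
      exact ⟨a + b, by simp [toPlane]⟩
  unfold polygonAdd
  rw [h1, hullOf_eq, hullOf_eq, hullOf_eq, ← convexHull_add, (convex_convexHull ℝ _).convexHull_eq,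
    h2]
  conv_rhs => rw [h3]
  rw [add_add_add_comm]

open scoped Pointwise in
theorem isLeast_weight_add {S T : Set (ℕ × ℕ)} {t m n : ℝ}
    (hS : IsLeast ((fun a => weight t (toPlane a)) '' S) m)
    (hT : IsLeast ((fun a => weight t (toPlane a)) '' T) n) :
    IsLeast ((fun a => weight t (toPlane a)) '' (S + T)) (m + n) := by
  obtain ⟨⟨a, ha, rfl⟩, hm⟩ := hS
  obtain ⟨⟨b, hb, rfl⟩, hn⟩ := hT
  have hadd : ∀ a b, weight t (toPlane (a + b)) = weight t (toPlane a) + weight t (toPlane b) :=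
    fun a b => by rw [← map_add]; simp [toPlane]
  refine ⟨⟨a + b, Set.add_mem_add ha hb, hadd a b⟩, ?_⟩
  rintro _ ⟨_, ⟨c, hc, d, hd, rfl⟩, rfl⟩
  simp only [hadd]
  exact add_le_add (hm ⟨c, hc, rfl⟩) (hn ⟨d, hd, rfl⟩)

/-- A sum of elementary polygons is a Newton polygon with explicit support function. -/
theorem exists_elementarySum_eq_hullOf (D : List (ℕ × ℕ)) : ∃ S : Set (ℕ × ℕ),
    elementarySum D = hullOf S ∧ ∀ t, IsLeast ((fun a => weight t (toPlane a)) '' S)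
      (D.map fun d => min (t * d.1) (d.2 : ℝ)).sum := by
  induction D with
  | nil => exact ⟨{(0, 0)}, rfl, fun t => by simp [toPlane]⟩
  | cons d D ih =>
    obtain ⟨S, hS, h⟩ := ih
    open scoped Pointwise in
    refine ⟨{(d.1, 0), (0, d.2)} + S, ?_, fun t => ?_⟩
    · rw [elementarySum, List.foldr_cons, ← elementarySum, hS, elementary, polygonAdd_hullOf]
    · rw [List.map_cons, List.sum_cons]
      refine isLeast_weight_add ?_ (h t)
      rw [Set.image_pair]
      simpa [toPlane] using isLeast_pair (a := t * (d.1 : ℝ)) (b := (d.2 : ℝ))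

/-- A minimal face of a hull is the hull of the generators on it: the points with $f>m$, together
with that smaller hull, form a convex set containing $A$. -/
theorem mem_convexHull_inter_of_eq {E : Type*} [AddCommGroup E] [Module ℝ E] (f : E →ₗ[ℝ] ℝ)
    {A : Set E} {m : ℝ} (h : ∀ a ∈ A, m ≤ f a) {p : E} (hp : p ∈ convexHull ℝ A) (hpm : f p = m) :
    p ∈ convexHull ℝ (A ∩ {x | f x = m}) := by
  have hc : Convex ℝ {x | m < f x ∨ f x = m ∧ x ∈ convexHull ℝ (A ∩ {x | f x = m})} := by
    intro x hx y hy a b ha hb hab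
    obtain rfl | ha := ha.eq_or_lt
    · obtain rfl : b = 1 := by linarith
      simpa using hy
    obtain rfl | hb := hb.eq_or_lt
    · obtain rfl : a = 1 := by linarith
      simpa using hx
    have hb' : b = 1 - a := by linarith
    simp only [Set.mem_ofPred_eq, map_add, map_smul, smul_eq_mul] at hx hy ⊢
    rcases hx with hx | ⟨hx, hx'⟩
    · left
      have : m ≤ f y := hy.elim le_of_lt fun h => h.1.ge
      subst hb'
      nlinarith
    rcases hy with hy | ⟨hy, hy'⟩
    · left
      subst hb'
      nlinarith
    · right
      refine ⟨?_, convex_convexHull ℝ _ hx' hy' ha.le hb.le hab⟩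
      rw [hx, hy, ← add_mul, hab, one_mul]
  have := convexHull_min (fun a ha => ?_) hc hp
  · rcases this with h | h
    · exact absurd hpm h.ne'
    · exact h.2
  · rcases (h a ha).eq_or_lt with h | h
    · exact Or.inr ⟨h.symm, subset_convexHull ℝ _ ⟨ha, h.symm⟩⟩
    · exact Or.inl h

/-- Newton polygons of finite area meet both axes. -/
theorem exists_mem_axes {S : Set (ℕ × ℕ)} (h : HasFiniteArea (hullOf S)) :
    (∃ l, (l, 0) ∈ S) ∧ ∃ k, (0, k) ∈ S := by
  have aux : ∀ (f : (ℝ × ℝ) →ₗ[ℝ] ℝ), (∀ b, 0 ≤ f (toPlane b)) → (∀ a ∈ S, 1 ≤ f (toPlane a)) →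
      hullOf S ⊆ {p | 1 ≤ f p} := fun f hf h1 => by
    refine convexHull_min ?_ (convex_halfSpace_ge f.isLinear 1)
    rintro _ ⟨a, ha, b, rfl⟩
    have : toPlane (a + b) = toPlane a + toPlane b := by simp [toPlane]
    rw [Set.mem_ofPred_eq, this, map_add]
    linarith [h1 a ha, hf b]
  constructor
  · by_contra! hl
    have hsub := aux (LinearMap.snd ℝ ℝ ℝ) (fun b => by simp [toPlane]) fun a ha => by
      have : a.2 ≠ 0 := fun h0 => hl a.1 (by rwa [← h0])
      simpa [toPlane] using Nat.one_le_iff_ne_zero.2 this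
    -- Without an exponent on the horizontal axis, the complement contains a strip of height 1 and
    -- infinite length.
    refine absurd h (not_lt.2 (le_trans ?_ (MeasureTheory.measure_mono
      (s := Set.Ici (0 : ℝ) ×ˢ Set.Ico (0 : ℝ) 1) ?_)))
    · rw [MeasureTheory.Measure.volume_eq_prod, MeasureTheory.Measure.prod_prod]
      simp
    · rintro p ⟨hp1, hp2, hp3⟩
      exact ⟨⟨hp1, hp2⟩, fun hp => absurd hp3 (not_lt.2 (hsub hp))⟩
  · by_contra! hl
    have hsub := aux (LinearMap.fst ℝ ℝ ℝ) (fun b => by simp [toPlane]) fun a ha => by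
      have : a.1 ≠ 0 := fun h0 => hl a.2 (by rwa [← h0])
      simpa [toPlane] using Nat.one_le_iff_ne_zero.2 this
    refine absurd h (not_lt.2 (le_trans ?_ (MeasureTheory.measure_mono
      (s := Set.Ico (0 : ℝ) 1 ×ˢ Set.Ici (0 : ℝ)) ?_)))
    · rw [MeasureTheory.Measure.volume_eq_prod, MeasureTheory.Measure.prod_prod]
      simp
    · rintro p ⟨⟨hp1, hp3⟩, hp2⟩
      exact ⟨⟨hp1, hp2⟩, fun hp => absurd hp3 (not_lt.2 (hsub hp))⟩

/-! ### Gauss norms and Newton polygons -/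

/-- `v` is a nonarchimedean absolute value on `L` that restricts along `φ` to the `X`-adic absolute
value with `|X| = ρ`. -/
structure IsAdicExtension {L : Type*} [Field L] (φ : PowerSeries ℂ →+* L) (v : AbsoluteValue L ℝ)
    (ρ : ℝ) : Prop where
  nonarch : IsNonarchimedean v
  le_one : ∀ f, v (φ f) ≤ 1
  map_X : v (φ PowerSeries.X) = ρ
  pos : 0 < ρ
  lt_one : ρ < 1

/-- The exponents of the monomials of `P`. -/
def exponents (P : Cz[X]) : Set (ℕ × ℕ) := {a | coeffAt P a.1 a.2 ≠ 0}

theorem newtonPolygon_eq (P : Cz[X]) : newtonPolygon P = hullOf (exponents P) := rfl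

section

variable {L : Type*} [Field L] {φ : PowerSeries ℂ →+* L} {v : AbsoluteValue L ℝ} {ρ : ℝ}

theorem IsAdicExtension.le_pow (H : IsAdicExtension φ v ρ) {f : PowerSeries ℂ} {i : ℕ}
    (hf : ∀ k < i, PowerSeries.coeff k f = 0) : v (φ f) ≤ ρ ^ i := by
  obtain ⟨g, rfl⟩ := PowerSeries.X_pow_dvd_iff.2 hf
  rw [map_mul, map_mul, map_pow, map_pow, H.map_X]
  exact mul_le_of_le_one_right (pow_nonneg H.pos.le _) (H.le_one g)

theorem IsAdicExtension.eq_one (H : IsAdicExtension φ v ρ) {f : PowerSeries ℂ} (hf : IsUnit f) :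
    v (φ f) = 1 := by
  obtain ⟨g, hg⟩ := hf.exists_right_inv
  refine le_antisymm (H.le_one f) ?_
  have h1 : v (φ f) * v (φ g) = 1 := by rw [← map_mul, ← map_mul, hg, map_one, map_one]
  rw [← h1]
  exact mul_le_of_le_one_right (v.nonneg _) (H.le_one g)

theorem IsAdicExtension.eq_pow (H : IsAdicExtension φ v ρ) {f : PowerSeries ℂ} {i : ℕ}
    (hf : ∀ k < i, PowerSeries.coeff k f = 0) (hi : PowerSeries.coeff i f ≠ 0) :
    v (φ f) = ρ ^ i := by
  obtain ⟨g, rfl⟩ := PowerSeries.X_pow_dvd_iff.2 hf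
  have hg : IsUnit g := by
    rw [PowerSeries.isUnit_iff_constantCoeff, isUnit_iff_ne_zero]
    have := PowerSeries.coeff_X_pow_mul g i 0
    rw [zero_add] at this
    rw [this] at hi
    simpa using hi
  rw [map_mul, map_mul, map_pow, map_pow, H.map_X, H.eq_one hg, mul_one]

theorem IsAdicExtension.exists_eq_pow (H : IsAdicExtension φ v ρ) {f : PowerSeries ℂ} (hf : f ≠ 0) :
    ∃ i, PowerSeries.coeff i f ≠ 0 ∧ (∀ k < i, PowerSeries.coeff k f = 0) ∧ v (φ f) = ρ ^ i := by
  classical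
  have h : ∃ i, PowerSeries.coeff i f ≠ 0 := PowerSeries.exists_coeff_ne_zero_iff_ne_zero.2 hf
  have hlt : ∀ k < Nat.find h, PowerSeries.coeff k f = 0 := fun k hk => not_not.1 (Nat.find_min h hk)
  exact ⟨Nat.find h, Nat.find_spec h, hlt, H.eq_pow hlt (Nat.find_spec h)⟩

theorem IsAdicExtension.injective (H : IsAdicExtension φ v ρ) : Function.Injective φ := by
  rw [injective_iff_map_eq_zero]
  intro f hf
  by_contra h
  obtain ⟨i, -, -, hi⟩ := H.exists_eq_pow h
  rw [hf, map_zero] at hi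
  exact (pow_pos H.pos i).ne hi

theorem IsAdicExtension.map_C (H : IsAdicExtension φ v ρ) {c : ℂ} (hc : c ≠ 0) :
    v (φ (PowerSeries.C c)) = 1 :=
  H.eq_one ((isUnit_iff_ne_zero.2 hc).map PowerSeries.C)

/-- The restriction to convergent power series. -/
noncomputable def restrictCz (φ : PowerSeries ℂ →+* L) : Cz →+* L := φ.comp convergentSeries.subtype

theorem restrictCz_apply (f : Cz) : restrictCz φ f = φ (f : PowerSeries ℂ) := rfl

theorem IsAdicExtension.restrictCz_injective (H : IsAdicExtension φ v ρ) :
    Function.Injective (restrictCz φ) :=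
  H.injective.comp Subtype.val_injective

/-- The column $j$ contributes $v(a_j)\rho^{tj}=\rho^{tj+i}$, with $i$ the order of $a_j$. Since
$\rho<1$, the logarithm turns the maximum over columns into a minimum of weights. -/
theorem IsAdicExtension.isLeast_gaussNorm (H : IsAdicExtension φ v ρ) {P : Cz[X]} (hP : P ≠ 0)
    {t : ℝ} : IsLeast ((fun a => weight t (toPlane a)) '' exponents P)
      (Real.logb ρ ((P.map (restrictCz φ)).gaussNorm v (ρ ^ t))) := by
  have hc : 0 < ρ ^ t := Real.rpow_pos_of_pos H.pos t
  have hpow : ∀ i j : ℕ, ρ ^ i * (ρ ^ t) ^ j = ρ ^ (t * j + i) := fun i j => by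
    rw [Real.rpow_add H.pos, Real.rpow_mul H.pos.le, Real.rpow_natCast, Real.rpow_natCast, mul_comm]
  set Q := P.map (restrictCz φ) with hQ
  have hQ0 : Q ≠ 0 := (Polynomial.map_ne_zero_iff H.restrictCz_injective).2 hP
  have hG : Q.gaussNorm v (ρ ^ t) ≠ 0 := by
    rw [Ne, Polynomial.gaussNorm_eq_zero_iff v Q (fun x => v.eq_zero.1) hc]
    exact hQ0
  obtain ⟨j, hj⟩ := Q.exists_eq_gaussNorm v (ρ ^ t)
  have hj0 : (P.coeff j : PowerSeries ℂ) ≠ 0 := by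
    intro h0
    rw [hj, hQ, Polynomial.coeff_map, restrictCz_apply, h0, map_zero, map_zero, zero_mul] at hG
    exact hG rfl
  obtain ⟨i, hi, -, hv⟩ := H.exists_eq_pow hj0
  have hval : Q.gaussNorm v (ρ ^ t) = ρ ^ (t * j + i) := by
    rw [hj, hQ, Polynomial.coeff_map, restrictCz_apply, hv, hpow]
  rw [hval, Real.logb_rpow H.pos H.lt_one.ne]
  refine ⟨⟨(j, i), hi, by simp [toPlane]⟩, ?_⟩
  rintro _ ⟨⟨j', i'⟩, ha, rfl⟩
  have hj' : (P.coeff j' : PowerSeries ℂ) ≠ 0 := fun h0 => ha (by simp [coeffAt, h0])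
  obtain ⟨k, -, hk', hvk⟩ := H.exists_eq_pow hj'
  have hki : k ≤ i' := by
    by_contra! hlt
    exact ha (hk' _ hlt)
  have hle := Q.le_gaussNorm v hc.le j'
  rw [hval, hQ, Polynomial.coeff_map, restrictCz_apply, hvk, hpow,
    Real.rpow_le_rpow_left_iff_of_base_lt_one H.pos H.lt_one] at hle
  have : (k : ℝ) ≤ i' := by exact_mod_cast hki
  simp only [weight_apply, toPlane]
  linarith

theorem gaussNorm_X_sub_C {c : ℝ} (hc : 0 < c) (α : L) :
    (Polynomial.X - Polynomial.C α).gaussNorm v c = max c (v α) := by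
  have h0 : v ((Polynomial.X - Polynomial.C α).coeff 0) * c ^ 0 = v α := by simp
  have h1 : v ((Polynomial.X - Polynomial.C α).coeff 1) * c ^ 1 = c := by
    simp
  refine le_antisymm ?_ (max_le ?_ ?_)
  · obtain ⟨i, hi⟩ := (Polynomial.X - Polynomial.C α).exists_eq_gaussNorm v c
    rw [hi]
    match i with
    | 0 => rw [h0]; exact le_max_right _ _
    | 1 => rw [h1]; exact le_max_left _ _
    | i + 2 =>
      have : (Polynomial.X - Polynomial.C α).coeff (i + 2) = 0 :=
        Polynomial.coeff_eq_zero_of_natDegree_lt (by simp)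
      rw [this, map_zero, zero_mul]
      exact le_max_of_le_left hc.le
  · conv_lhs => rw [← h1]
    exact Polynomial.le_gaussNorm v _ hc.le 1
  · conv_lhs => rw [← h0]
    exact Polynomial.le_gaussNorm v _ hc.le 0

theorem gaussNorm_neg_one {c : ℝ} : (-1 : L[X]).gaussNorm v c = 1 := by
  have : (-1 : L[X]) = Polynomial.C (-1) := by simp
  rw [this, Polynomial.gaussNorm_C, v.map_neg, map_one]

theorem IsAdicExtension.gaussNorm_prod (H : IsAdicExtension φ v ρ) {c : ℝ} (hc : 0 < c)
    {ι : Type*} (A : Multiset ι) (f : ι → L[X]) :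
    (A.map f).prod.gaussNorm v c = (A.map fun i => (f i).gaussNorm v c).prod := by
  induction A using Multiset.induction_on with
  | empty =>
    have : (1 : L[X]) = Polynomial.C 1 := by simp
    simp only [Multiset.map_zero, Multiset.prod_zero]
    rw [this, Polynomial.gaussNorm_C, map_one]
  | cons a A ih =>
    rw [Multiset.map_cons, Multiset.prod_cons, Polynomial.gaussNorm_mul H.nonarch hc, ih,
      Multiset.map_cons, Multiset.prod_cons]

/-- The order of `α`, normalized so that the uniformizer has order `1`. -/
noncomputable def ordOf (v : AbsoluteValue L ℝ) (ρ : ℝ) (α : L) : ℝ := Real.logb ρ (v α)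

theorem IsAdicExtension.rpow_ordOf (H : IsAdicExtension φ v ρ) {α : L} (hα : α ≠ 0) :
    ρ ^ ordOf v ρ α = v α :=
  Real.rpow_logb H.pos H.lt_one.ne (v.pos hα)

theorem IsAdicExtension.max_eq (H : IsAdicExtension φ v ρ) {α : L} (hα : α ≠ 0) (t : ℝ) :
    max (ρ ^ t) (v α) = ρ ^ min t (ordOf v ρ α) := by
  have hanti : Antitone fun x : ℝ => ρ ^ x := fun x y h =>
    Real.rpow_le_rpow_of_exponent_ge H.pos H.lt_one.le h
  rw [hanti.map_min, H.rpow_ordOf hα]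

/-- Multiplicativity of the Gauss norm. The factors are left general so that the lemma serves both
the roots of $P$ and the differences of roots in the resultant. -/
theorem IsAdicExtension.isLeast_sum (H : IsAdicExtension φ v ρ) {P : Cz[X]} {ι : Type*}
    (A : Multiset ι) (f : ι → L[X]) (r : ι → ℝ) {t : ℝ} (hP : P.map (restrictCz φ) = (A.map f).prod)
    (hf : ∀ i ∈ A, (f i).gaussNorm v (ρ ^ t) = ρ ^ min t (r i)) :
    IsLeast ((fun a => weight t (toPlane a)) '' exponents P) (A.map fun i => min t (r i)).sum := by
  have hprod : ((A.map f).prod).gaussNorm v (ρ ^ t) = ρ ^ (A.map fun i => min t (r i)).sum := by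
    rw [H.gaussNorm_prod (Real.rpow_pos_of_pos H.pos t), Multiset.map_congr rfl hf]
    clear hP hf
    induction A using Multiset.induction_on with
    | empty => simp
    | cons a A ih => simp [ih, Real.rpow_add H.pos]
  have hP0 : P ≠ 0 := by
    rintro rfl
    rw [← hP, Polynomial.map_zero, Polynomial.gaussNorm_zero] at hprod
    exact (Real.rpow_pos_of_pos H.pos _).ne hprod
  have := H.isLeast_gaussNorm hP0 (t := t)
  rwa [hP, hprod, Real.logb_rpow H.pos H.lt_one.ne] at this

theorem map_eq_prod_roots [IsAlgClosed L] {P : Cz[X]} (hP : P.Monic) :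
    P.map (restrictCz φ) = ((P.map (restrictCz φ)).roots.map
      fun α => Polynomial.X - Polynomial.C α).prod :=
  (IsAlgClosed.splits _).eq_prod_roots_of_monic (hP.map _)

/-- A point on the vertical axis means $P(z_1,0)\ne0$. Zero must be excluded because `ordOf` takes
the default value 0 there. -/
theorem IsAdicExtension.root_ne_zero (H : IsAdicExtension φ v ρ) {P : Cz[X]}
    (h0 : ∃ k, (0, k) ∈ exponents P) {α : L} (hα : (P.map (restrictCz φ)).IsRoot α) : α ≠ 0 := by
  rintro rfl
  obtain ⟨k, hk⟩ := h0
  rw [Polynomial.IsRoot, ← Polynomial.coeff_zero_eq_eval_zero, Polynomial.coeff_map,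
    map_eq_zero_iff _ H.restrictCz_injective] at hα
  exact hk (by simp [coeffAt, hα])

theorem IsAdicExtension.isLeast_roots [IsAlgClosed L] (H : IsAdicExtension φ v ρ) {P : Cz[X]}
    (hP : P.Monic) (h0 : ∃ k, (0, k) ∈ exponents P) (t : ℝ) :
    IsLeast ((fun a => weight t (toPlane a)) '' exponents P)
      ((P.map (restrictCz φ)).roots.map fun α => min t (ordOf v ρ α)).sum := by
  refine H.isLeast_sum _ _ _ (map_eq_prod_roots hP) fun α hα => ?_
  rw [gaussNorm_X_sub_C (Real.rpow_pos_of_pos H.pos t),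
    H.max_eq (H.root_ne_zero h0 (Polynomial.isRoot_of_mem_roots hα))]

/-- At radius 1 the Gauss norm of $P$ is at most 1, while every factor has norm
$\max(1,|\beta|)\ge1$. -/
theorem IsAdicExtension.root_le_one [IsAlgClosed L] (H : IsAdicExtension φ v ρ) {P : Cz[X]}
    (hP : P.Monic) {α : L} (hα : (P.map (restrictCz φ)).IsRoot α) : v α ≤ 1 := by
  have hmem : α ∈ (P.map (restrictCz φ)).roots := (Polynomial.mem_roots (hP.map _).ne_zero).2 hα
  have h1 : (P.map (restrictCz φ)).gaussNorm v 1 ≤ 1 := by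
    obtain ⟨j, hj⟩ := (P.map (restrictCz φ)).exists_eq_gaussNorm v 1
    rw [hj, one_pow, mul_one, Polynomial.coeff_map]
    exact H.le_one _
  obtain ⟨B, hB⟩ := Multiset.exists_cons_of_mem hmem
  rw [map_eq_prod_roots hP, hB, H.gaussNorm_prod one_pos, Multiset.map_cons, Multiset.prod_cons,
    gaussNorm_X_sub_C one_pos] at h1
  have h2 : 1 ≤ (B.map fun β => (Polynomial.X - Polynomial.C β).gaussNorm v 1).prod := by
    refine Multiset.prod_induction (fun x => (1 : ℝ) ≤ x) _ (fun a b => one_le_mul_of_one_le_of_one_le)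
      le_rfl fun x hx => ?_
    obtain ⟨β, -, rfl⟩ := Multiset.mem_map.1 hx
    rw [gaussNorm_X_sub_C one_pos]
    exact le_max_left _ _
  calc v α ≤ max 1 (v α) := le_max_right _ _
    _ ≤ max 1 (v α) * _ := le_mul_of_one_le_right (by positivity) h2
    _ ≤ 1 := h1

theorem IsAdicExtension.ordOf_nonneg [IsAlgClosed L] (H : IsAdicExtension φ v ρ) {P : Cz[X]}
    (hP : P.Monic) {α : L} (hα : (P.map (restrictCz φ)).IsRoot α) : 0 ≤ ordOf v ρ α :=
  div_nonneg_of_nonpos (Real.log_nonpos (v.nonneg _) (H.root_le_one hP hα))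
    (Real.log_neg H.pos H.lt_one).le

end

/-! ### The resultant as a product over pairs of roots -/

theorem natDegree_comp_C_X_add_X {V : Type*} [CommRing V] [Nontrivial V] {P : V[X]} (hP : P.Monic) :
    ((P.map Polynomial.C).comp (Polynomial.C Polynomial.X + Polynomial.X) : V[X][X]).natDegree =
      P.natDegree := by
  rw [add_comm, Polynomial.natDegree_comp_eq_of_mul_ne_zero, Polynomial.natDegree_X_add_C, mul_one,
    hP.natDegree_map]
  simp [(hP.map _).leadingCoeff]

/-- The resultant depends on the degrees of its arguments; monicity keeps them unchanged under the
base change. -/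
theorem map_resultantPoly {V W : Type*} [CommRing V] [CommRing W] [Nontrivial V] [Nontrivial W]
    (f : V →+* W) {P Q : V[X]} (hP : P.Monic) (hQ : Q.Monic) :
    (resultantPoly P Q).map f = resultantPoly (P.map f) (Q.map f) := by
  have hcomp : (Polynomial.mapRingHom f).comp Polynomial.C = Polynomial.C.comp f := by
    ext; simp
  unfold resultantPoly
  rw [← Polynomial.coe_mapRingHom f, ← Polynomial.resultant_map_map, Polynomial.coe_mapRingHom]
  rw [natDegree_comp_C_X_add_X hP, natDegree_comp_C_X_add_X (hP.map f),
    hQ.natDegree_map Polynomial.C, (hQ.map f).natDegree_map Polynomial.C, hP.natDegree_map,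
    hQ.natDegree_map, Polynomial.map_comp, Polynomial.map_map, Polynomial.map_map,
    Polynomial.map_map, Polynomial.map_map, hcomp,
    Polynomial.map_add, Polynomial.map_C, Polynomial.map_X, Polynomial.coe_mapRingHom,
    Polynomial.map_X]

/-- As a polynomial in $U$, $P(T+U)$ has the roots $\alpha-T$; evaluating $Q$ there gives the
factors $\alpha-T-\beta=-(T-(\alpha-\beta))$. -/
theorem resultantPoly_eq_prod {L : Type*} [Field L] (A B : Multiset L) :
    resultantPoly (A.map fun α => Polynomial.X - Polynomial.C α).prod
      (B.map fun β => Polynomial.X - Polynomial.C β).prod =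
    (A.map fun α => (B.map fun β => -1 * (Polynomial.X - Polynomial.C (α - β))).prod).prod := by
  have h1 : (((A.map fun α => Polynomial.X - Polynomial.C α).prod.map Polynomial.C).comp
      (Polynomial.C Polynomial.X + Polynomial.X) : L[X][X]) =
      ((A.map fun α => Polynomial.C α - Polynomial.X).map
        fun γ => Polynomial.X - Polynomial.C γ).prod := by
    rw [Polynomial.map_multiset_prod, Polynomial.multiset_prod_comp]
    simp only [Multiset.map_map]
    congr 1
    refine Multiset.map_congr rfl fun α _ => ?_
    simp
    ring
  unfold resultantPoly
  rw [h1, Polynomial.resultant_eq_prod_eval _ _ _ le_rfl, Polynomial.roots_multiset_prod_X_sub_C,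
    (Polynomial.monic_multisetProd_X_sub_C _).leadingCoeff, one_pow, one_mul, Multiset.map_map]
  · congr 1
    refine Multiset.map_congr rfl fun α _ => ?_
    rw [Function.comp_apply, Polynomial.map_multiset_prod, Polynomial.eval_multiset_prod,
      Multiset.map_map, Multiset.map_map]
    congr 1
    refine Multiset.map_congr rfl fun β _ => ?_
    simp
    ring
  · refine Polynomial.Splits.multisetProd fun f hf => ?_
    obtain ⟨γ, -, rfl⟩ := Multiset.mem_map.1 hf
    exact Polynomial.Splits.X_sub_C γ

theorem sum_map_product {α β M : Type*} [AddCommMonoid M] (s : Multiset α) (t : Multiset β)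
    (f : α × β → M) :
    ((s ×ˢ t).map f).sum = (s.map fun i => (t.map fun j => f (i, j)).sum).sum := by
  induction s using Multiset.induction <;> simp_all

theorem IsAdicExtension.isLeast_resultantPoly {L : Type*} [Field L] [IsAlgClosed L]
    {φ : PowerSeries ℂ →+* L} {v : AbsoluteValue L ℝ} {ρ : ℝ} (H : IsAdicExtension φ v ρ)
    {P Q : Cz[X]} (hP : P.Monic) (hQ : Q.Monic) (hP0 : ∃ k, (0, k) ∈ exponents P)
    (hQ0 : ∃ k, (0, k) ∈ exponents Q)
    (h : ∀ α β, (P.map (restrictCz φ)).IsRoot α → (Q.map (restrictCz φ)).IsRoot β →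
      v (α - β) = max (v α) (v β)) (t : ℝ) :
    IsLeast ((fun a => weight t (toPlane a)) '' exponents (resultantPoly P Q))
      ((P.map (restrictCz φ)).roots.map fun α => ((Q.map (restrictCz φ)).roots.map fun β =>
        min t (min (ordOf v ρ α) (ordOf v ρ β))).sum).sum := by
  set A := (P.map (restrictCz φ)).roots with hA
  set B := (Q.map (restrictCz φ)).roots with hB
  have hprod : (resultantPoly P Q).map (restrictCz φ) = ((A ×ˢ B).map fun x =>
      -1 * (Polynomial.X - Polynomial.C (x.1 - x.2))).prod := by
    rw [map_resultantPoly _ hP hQ, map_eq_prod_roots hP, map_eq_prod_roots hQ,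
      resultantPoly_eq_prod]
    exact (Multiset.prod_map_product_eq_prod_prod A B fun x : L × L =>
      (-1 * (Polynomial.X - Polynomial.C (x.1 - x.2)) : L[X])).symm
  have := H.isLeast_sum (A ×ˢ B) _ (fun x => min (ordOf v ρ x.1) (ordOf v ρ x.2)) (t := t) hprod
    fun x hx => ?_
  · rwa [sum_map_product A B] at this
  · obtain ⟨h1, h2⟩ := Multiset.mem_product.1 hx
    have h1' := Polynomial.isRoot_of_mem_roots h1
    have h2' := Polynomial.isRoot_of_mem_roots h2
    have hc := Real.rpow_pos_of_pos H.pos t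
    rw [Polynomial.gaussNorm_mul H.nonarch hc, gaussNorm_neg_one, one_mul,
      gaussNorm_X_sub_C hc, h _ _ h1' h2', ← max_assoc,
      H.max_eq (H.root_ne_zero hP0 h1'), H.max_eq (H.root_ne_zero hQ0 h2'), min_assoc]

/-! ### Support functions that are sums of minima -/

theorem exists_pos_le_abs_sub (R : Multiset ℝ) (s : ℝ) :
    ∃ ε > 0, ∀ x ∈ R, x ≠ s → ε ≤ |x - s| := by
  induction R using Multiset.induction_on with
  | empty => exact ⟨1, one_pos, by simp⟩
  | cons a R ih =>
    obtain ⟨ε, hε, h⟩ := ih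
    by_cases ha : a = s
    · refine ⟨ε, hε, fun x hx hxs => ?_⟩
      rcases Multiset.mem_cons.1 hx with rfl | hx
      · exact absurd ha hxs
      · exact h x hx hxs
    · refine ⟨min ε |a - s|, lt_min hε (abs_pos.2 (sub_ne_zero.2 ha)), fun x hx hxs => ?_⟩
      rcases Multiset.mem_cons.1 hx with rfl | hx
      · exact min_le_right _ _
      · exact (min_le_left _ _).trans (h x hx hxs)

/-- The hypothesis says that no element of `R` lies strictly between `s` and `t`; on such an
interval the sum is affine in `t`. -/
theorem sum_min_eq {R : Multiset ℝ} {s t : ℝ} (hs : s ∉ R)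
    (h : ∀ x ∈ R, (x < s → x ≤ t) ∧ (s < x → t ≤ x)) :
    (R.map fun x => min t x).sum = t * (R.filter (s < ·)).card + (R.filter (· < s)).sum := by
  induction R using Multiset.induction_on with
  | empty => simp
  | cons a R ih =>
    have ha := h a (Multiset.mem_cons_self a R)
    rw [Multiset.map_cons, Multiset.sum_cons, ih (fun h => hs (Multiset.mem_cons_of_mem h))
      fun x hx => h x (Multiset.mem_cons_of_mem hx)]
    rcases lt_trichotomy a s with has | rfl | has
    · rw [Multiset.filter_cons_of_neg R (p := (s < ·)) has.not_gt,
        Multiset.filter_cons_of_pos R (p := (· < s)) has,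
        min_eq_right (ha.1 has), Multiset.sum_cons]
      ring
    · exact absurd (Multiset.mem_cons_self a R) hs
    · rw [Multiset.filter_cons_of_pos R (p := (s < ·)) has,
        Multiset.filter_cons_of_neg R (p := (· < s)) has.not_gt,
        min_eq_left (ha.2 has), Multiset.card_cons]
      push_cast
      ring

/-- Near $s$ the support function is affine with slope the number of $x>s$. The weight $tj+i$ of the
exponent attaining the minimum at $s$ lies above it and touches it at $s$, so $j$ equals that slope.
-/
theorem exists_vertex {S : Set (ℕ × ℕ)} {R : Multiset ℝ}
    (hS : ∀ t, 0 < t → IsLeast ((fun a => weight t (toPlane a)) '' S) (R.map fun x => min t x).sum)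
    {s : ℝ} (hs0 : 0 < s) (hs : s ∉ R) :
    ∃ i : ℕ, ((R.filter (s < ·)).card, i) ∈ S ∧ (i : ℝ) = (R.filter (· < s)).sum := by
  obtain ⟨ε, hε, h⟩ := exists_pos_le_abs_sub R s
  obtain ⟨⟨⟨j, i⟩, ha, hji⟩, -⟩ := hS s hs0
  rw [sum_min_eq hs fun x _ => ⟨le_of_lt, le_of_lt⟩] at hji
  simp only [weight_apply, toPlane] at hji
  have key : ∀ t, 0 < t → |t - s| < ε →
      t * (R.filter (s < ·)).card + (R.filter (· < s)).sum ≤ t * j + i := fun t ht hts => by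
    have := (hS t ht).2 ⟨(j, i), ha, rfl⟩
    rw [sum_min_eq hs fun x hx => ?_] at this
    · simpa [toPlane] using this
    · constructor
      · intro hxs
        have := h x hx hxs.ne
        rw [abs_of_neg (by linarith)] at this
        rw [abs_lt] at hts
        linarith
      · intro hxs
        have := h x hx hxs.ne'
        rw [abs_of_pos (by linarith)] at this
        rw [abs_lt] at hts
        linarith
  set δ := min ε s / 2 with hδ
  have hδ0 : 0 < δ := by positivity
  have hδε : δ < ε := by linarith [min_le_left ε s, lt_min hε hs0]
  have hδs : δ < s := by linarith [min_le_right ε s, lt_min hε hs0]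
  have h1 := key (s + δ) (by linarith) (by rwa [add_sub_cancel_left, abs_of_pos hδ0])
  have h2 := key (s - δ) (by linarith) (by rwa [sub_sub_cancel_left, abs_neg, abs_of_pos hδ0])
  have hj : (j : ℝ) = (R.filter (s < ·)).card := by
    refine le_antisymm (le_of_mul_le_mul_left ?_ hδ0) (le_of_mul_le_mul_left ?_ hδ0) <;> linarith
  refine ⟨i, ?_, ?_⟩
  · rwa [← Nat.cast_injective hj]
  · rw [hj] at hji
    linarith

/-- The two end points of the edge of slope `r`. -/
theorem exists_edge {S : Set (ℕ × ℕ)} {R : Multiset ℝ}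
    (hS : ∀ t, 0 < t → IsLeast ((fun a => weight t (toPlane a)) '' S) (R.map fun x => min t x).sum)
    {r : ℝ} (hr : 0 < r) :
    ∃ j i k : ℕ, (j + R.count r, i) ∈ S ∧ (j, i + k) ∈ S ∧ (k : ℝ) = R.count r * r ∧
      r * j + (i + k) = (R.map fun x => min r x).sum := by
  obtain ⟨ε, hε, h⟩ := exists_pos_le_abs_sub R r
  set δ := min ε r / 2 with hδ
  have hδ0 : 0 < δ := by positivity
  have hδε : δ < ε := by linarith [min_le_left ε r, lt_min hε hr]
  have hδr : δ < r := by linarith [min_le_right ε r, lt_min hε hr]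
  have habs : ∀ x ∈ R, x ≠ r → x ≤ r - ε ∨ r + ε ≤ x := fun x hx hxr => by
    rcases le_abs.1 (h x hx hxr) with h | h
    · right; linarith
    · left; linarith
  have hsplit : ∀ x ∈ R, x < r - δ ∧ x < r ∨ x = r ∨ r + δ < x ∧ r < x := fun x hx => by
    by_cases hxr : x = r
    · exact Or.inr (Or.inl hxr)
    · rcases habs x hx hxr with h | h
      · left; constructor <;> linarith
      · right; right; constructor <;> linarith
  have hn1 : r - δ ∉ R := fun hx => by
    rcases hsplit _ hx with ⟨h, -⟩ | h | ⟨h, -⟩ <;> linarith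
  have hn2 : r + δ ∉ R := fun hx => by
    rcases hsplit _ hx with ⟨h, -⟩ | h | ⟨h, -⟩ <;> linarith
  -- The vertices just below and just above the slope $r$ are the right and the left end of the
  -- edge.
  obtain ⟨i, hi, hi'⟩ := exists_vertex hS (s := r - δ) (by linarith) hn1
  obtain ⟨i', hi₂, hi₂'⟩ := exists_vertex hS (s := r + δ) (by linarith) hn2
  have hf1 : R.filter (r - δ < ·) = R.filter (r < ·) + R.filter (· = r) := by
    rw [Multiset.filter_add_filter, (Multiset.filter_eq_nil (p := fun x => r < x ∧ x = r)).2
      (fun x _ h => h.1.ne' h.2), add_zero]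
    refine Multiset.filter_congr fun x hx => ?_
    rcases hsplit x hx with ⟨h, h'⟩ | rfl | ⟨h, h'⟩
    · simp only [h.not_gt, h'.not_gt, h'.ne, or_self]
    · simp [hδ0]
    · simp only [h', true_or, iff_true]; linarith
  have hf2 : R.filter (r + δ < ·) = R.filter (r < ·) := by
    refine Multiset.filter_congr fun x hx => ?_
    rcases hsplit x hx with ⟨h, h'⟩ | rfl | ⟨h, h'⟩
    · simp only [h'.not_gt, iff_false]; linarith
    · simp [hδ0.le]
    · simp only [h, h']
  have hf3 : R.filter (· < r + δ) = R.filter (· < r - δ) + R.filter (· = r) := by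
    rw [Multiset.filter_add_filter, (Multiset.filter_eq_nil (p := fun x => x < r - δ ∧ x = r)).2
      (fun x _ h => by linarith [h.1, h.2]), add_zero]
    refine Multiset.filter_congr fun x hx => ?_
    rcases hsplit x hx with ⟨h, h'⟩ | rfl | ⟨h, h'⟩
    · simp only [h, true_or, iff_true]; linarith
    · simp [hδ0]
    · simp only [h.not_gt, h'.ne', or_false, false_iff]; linarith
  have hrep : R.filter (· = r) = Multiset.replicate (R.count r) r := Multiset.filter_eq' R r
  rw [hf2] at hi₂
  rw [hf1, hrep, Multiset.card_add, Multiset.card_replicate] at hi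
  rw [hf3, hrep, Multiset.sum_add, ← hi', Multiset.sum_replicate, nsmul_eq_mul] at hi₂'
  have hle : i ≤ i' := by
    have : (i : ℝ) ≤ i' := by rw [hi₂']; linarith [mul_nonneg (Nat.cast_nonneg (R.count r)) hr.le]
    exact_mod_cast this
  obtain ⟨k, rfl⟩ := Nat.exists_eq_add_of_le hle
  push_cast at hi₂'
  refine ⟨_, i, k, hi, hi₂, by linarith, ?_⟩
  rw [sum_min_eq hn1 (t := r) fun x hx => ?_, hf1, hrep, Multiset.card_add,
    Multiset.card_replicate, ← hi']
  · push_cast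
    linarith
  · rcases hsplit x hx with ⟨h, h'⟩ | rfl | ⟨h, h'⟩
    · exact ⟨fun _ => h'.le, fun h0 => by linarith⟩
    · exact ⟨fun _ => le_rfl, fun _ => le_rfl⟩
    · exact ⟨fun h0 => by linarith, fun _ => h'.le⟩

/-- A positive slope $r$ of multiplicity $m$ contributes $E(m,mr)$, where $mr$ is an integer because
it is the height of an edge between lattice points. Slopes 0 contribute nothing. -/
theorem exists_isDecomposition {S : Set (ℕ × ℕ)} {R : Multiset ℝ} (hR : ∀ r ∈ R, 0 ≤ r)
    (hS : ∀ t, 0 < t → IsLeast ((fun a => weight t (toPlane a)) '' S) (R.map fun x => min t x).sum) :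
    ∃ D, IsDecomposition (hullOf S) D := by
  have hk : ∀ r : ℝ, ∃ k : ℕ, 0 < r → (k : ℝ) = R.count r * r := fun r => by
    by_cases hr : 0 < r
    · obtain ⟨-, -, k, -, -, hk, -⟩ := exists_edge hS hr
      exact ⟨k, fun _ => hk⟩
    · exact ⟨0, fun h => absurd h hr⟩
  choose k hk using hk
  set F := R.toFinset.filter (0 < ·) with hF
  have hcount : ∀ r ∈ F, 0 < R.count r := fun r hr =>
    Multiset.count_pos.2 (Multiset.mem_toFinset.1 (Finset.mem_filter.1 hr).1)
  refine ⟨F.toList.map fun r => (R.count r, k r), fun d hd => ?_, ?_⟩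
  · obtain ⟨r, hr, rfl⟩ := List.mem_map.1 hd
    rw [Finset.mem_toList] at hr
    have hr0 := (Finset.mem_filter.1 hr).2
    have hc := hcount r hr
    refine ⟨hc, ?_⟩
    have : (0 : ℝ) < k r := by rw [hk r hr0]; positivity
    exact_mod_cast this
  · obtain ⟨T, hT, h⟩ := exists_elementarySum_eq_hullOf (F.toList.map fun r => (R.count r, k r))
    rw [hT]
    refine hullOf_eq_of_isLeast _ hS fun t ht => ?_
    convert h t using 1
    rw [List.map_map, Finset.sum_map_toList, Finset.sum_multiset_map_count]
    rw [hF, Finset.sum_filter]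
    refine Finset.sum_congr rfl fun r hr => ?_
    have hr' := hR r (Multiset.mem_toFinset.1 hr)
    split_ifs with h0
    · rw [Function.comp_apply, hk r h0, nsmul_eq_mul, mul_min_of_nonneg _ _ (Nat.cast_nonneg _),
        mul_comm t]
    · obtain rfl : r = 0 := le_antisymm (not_lt.1 h0) hr'
      rw [min_eq_right ht.le, smul_zero]

/-- Both sides are the support function of the same polygon, so the chosen decomposition is
immaterial. The value $t=0$ is included because later $t$ is replaced by $\min(t,y)$ with $y$
possibly 0. -/
theorem IsDecomposition.sum_min_eq {S : Set (ℕ × ℕ)} {R : Multiset ℝ} {D : List (ℕ × ℕ)}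
    (hD : IsDecomposition (hullOf S) D) (hR : ∀ r ∈ R, 0 ≤ r)
    (hS : ∀ t, 0 < t → IsLeast ((fun a => weight t (toPlane a)) '' S) (R.map fun x => min t x).sum)
    {t : ℝ} (ht : 0 ≤ t) :
    ((D : Multiset (ℕ × ℕ)).map fun d => min (t * d.1) (d.2 : ℝ)).sum =
      (R.map fun x => min t x).sum := by
  obtain rfl | ht := ht.eq_or_lt
  · rw [Multiset.sum_eq_zero, Multiset.sum_eq_zero]
    · intro x hx
      obtain ⟨r, hr, rfl⟩ := Multiset.mem_map.1 hx
      exact min_eq_left (hR r hr)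
    · intro x hx
      obtain ⟨d, -, rfl⟩ := Multiset.mem_map.1 hx
      simp
  · obtain ⟨T, hT, h⟩ := exists_elementarySum_eq_hullOf D
    rw [Multiset.map_coe, Multiset.sum_coe]
    exact eq_of_isLeast_of_hullOf_eq ht.le (h t) (hS t ht) (by rw [← hT, ← hD.2])

/-- In terms of support functions, multiplying by $E(\ell,h)$ truncates $t$ at the slope $h/\ell$
and repeats $\ell$ times. This makes the product computable one factor at a time. -/
theorem min_elementaryMul {d e : ℕ × ℕ} (hd : 0 < d.1) (t : ℝ) :
    min (t * (elementaryMul d e).1) ((elementaryMul d e).2 : ℝ) =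
      d.1 * min (min t (d.2 / d.1) * e.1) (e.2 : ℝ) := by
  have hd' : (0 : ℝ) < d.1 := by exact_mod_cast hd
  have he' : (0 : ℝ) ≤ e.1 := Nat.cast_nonneg _
  simp only [elementaryMul]
  push_cast
  rw [mul_min_of_nonneg _ _ hd'.le, min_mul_of_nonneg _ _ he', mul_min_of_nonneg _ _ hd'.le,
    min_assoc, min_comm ((d.1 : ℝ) * e.2)]
  congr 1
  · ring
  · congr 1
    field_simp

/-- By `min_elementaryMul`, the sum over `E` can be traded for one over `Q`; after exchanging the
sums, `D` is traded for `R` in the same way. -/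
theorem sum_elementaryMul {S T : Set (ℕ × ℕ)} {R Q : Multiset ℝ} {D E : List (ℕ × ℕ)}
    (hD : IsDecomposition (hullOf S) D) (hE : IsDecomposition (hullOf T) E)
    (hR : ∀ r ∈ R, 0 ≤ r) (hQ : ∀ r ∈ Q, 0 ≤ r)
    (hS : ∀ t, 0 < t → IsLeast ((fun a => weight t (toPlane a)) '' S) (R.map fun x => min t x).sum)
    (hT : ∀ t, 0 < t → IsLeast ((fun a => weight t (toPlane a)) '' T) (Q.map fun x => min t x).sum)
    {t : ℝ} (ht : 0 < t) :
    (((D ×ˢ E).map fun de => elementaryMul de.1 de.2).map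
      fun d => min (t * d.1) (d.2 : ℝ)).sum = (R.map fun x => (Q.map fun y =>
        min t (min x y)).sum).sum := by
  rw [List.map_map, ← Multiset.sum_coe, ← Multiset.map_coe, ← Multiset.coe_product,
    sum_map_product]
  have h1 : ∀ d ∈ (D : Multiset (ℕ × ℕ)), ((E : Multiset (ℕ × ℕ)).map fun e =>
      ((fun d : ℕ × ℕ => min (t * d.1) (d.2 : ℝ)) ∘ fun de => elementaryMul de.1 de.2) (d, e)).sum =
      (Q.map fun y => min (min t y * d.1) (d.2 : ℝ)).sum := fun d hd => by
    have hd0 := (hD.1 d hd).1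
    have hd' : (0 : ℝ) < d.1 := by exact_mod_cast hd0
    simp only [Function.comp_apply, min_elementaryMul hd0]
    rw [Multiset.sum_map_mul_left, hE.sum_min_eq hQ hT (by positivity), ← Multiset.sum_map_mul_left]
    congr 1
    refine Multiset.map_congr rfl fun y _ => ?_
    rw [min_right_comm, mul_min_of_nonneg _ _ hd'.le, mul_div_cancel₀ _ hd'.ne', mul_comm]
  rw [Multiset.map_congr rfl h1, Multiset.sum_map_sum_map]
  conv_rhs => rw [Multiset.sum_map_sum_map]
  congr 1
  refine Multiset.map_congr rfl fun y hy => ?_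
  rw [hD.sum_min_eq hR hS (le_min ht.le (hQ y hy))]
  congr 1
  refine Multiset.map_congr rfl fun x _ => ?_
  rw [min_assoc, min_comm y]

theorem hullOf_eq_polygonMul {S T U : Set (ℕ × ℕ)} {R Q : Multiset ℝ}
    (hR : ∀ r ∈ R, 0 ≤ r) (hQ : ∀ r ∈ Q, 0 ≤ r)
    (hS : ∀ t, 0 < t → IsLeast ((fun a => weight t (toPlane a)) '' S) (R.map fun x => min t x).sum)
    (hT : ∀ t, 0 < t → IsLeast ((fun a => weight t (toPlane a)) '' T) (Q.map fun x => min t x).sum)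
    (hU : ∀ t, 0 < t → IsLeast ((fun a => weight t (toPlane a)) '' U)
      (R.map fun x => (Q.map fun y => min t (min x y)).sum).sum) :
    hullOf U = polygonMul (hullOf S) (hullOf T) := by
  have key : ∀ {S : Set (ℕ × ℕ)}, (∃ D, IsDecomposition (hullOf S) D) →
      IsDecomposition (hullOf S) (decomposition (hullOf S)) := fun h => by
    rw [decomposition, dif_pos h]
    exact h.choose_spec
  obtain ⟨V, hV, h⟩ := exists_elementarySum_eq_hullOf
    ((decomposition (hullOf S) ×ˢ decomposition (hullOf T)).map fun de => elementaryMul de.1 de.2)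
  rw [polygonMul, hV]
  refine hullOf_eq_of_isLeast _ hU fun t ht => ?_
  rw [← sum_elementaryMul (key (exists_isDecomposition hR hS)) (key (exists_isDecomposition hQ hT))
    hR hQ hS hT ht]
  exact h t

/-! ### Faces and their polynomials -/

/-- The face of `N` on which `q * x + p * y` is minimal. -/
def face (N : Set (ℝ × ℝ)) (q p : ℕ) : Set (ℝ × ℝ) :=
  {x ∈ N | ∀ y ∈ N, (q : ℝ) * x.1 + p * x.2 ≤ q * y.1 + p * y.2}

/-- The lattice points with first coordinate at most `d` on the line `q * x + p * y = M`. -/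
def lineIndex (d q p M : ℕ) : Finset (ℕ × ℕ) :=
  (Finset.range (d + 1) ×ˢ Finset.range (M + 1)).filter fun a => q * a.1 + p * a.2 = M

/-- The terms of `P` on the line `q * x + p * y = M`, at `z₁ = 1`. -/
noncomputable def linePoly (P : Cz[X]) (d q p M : ℕ) : ℂ[X] :=
  ∑ a ∈ lineIndex d q p M, Polynomial.monomial a.1 (coeffAt P a.1 a.2)

theorem mem_lineIndex {d q p M : ℕ} (hp : 0 < p) {a : ℕ × ℕ} :
    a ∈ lineIndex d q p M ↔ a.1 ≤ d ∧ q * a.1 + p * a.2 = M := by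
  simp only [lineIndex, Finset.mem_filter, Finset.mem_product, Finset.mem_range]
  constructor
  · rintro ⟨⟨h1, -⟩, h2⟩
    exact ⟨by omega, h2⟩
  · rintro ⟨h1, h2⟩
    have : a.2 ≤ p * a.2 := Nat.le_mul_of_pos_left _ hp
    exact ⟨⟨by omega, by omega⟩, h2⟩

theorem le_of_mem_hullOf {S : Set (ℕ × ℕ)} {q p M : ℕ} (hp : 0 < p)
    (hM : ∀ a ∈ S, M ≤ q * a.1 + p * a.2) {x : ℝ × ℝ} (hx : x ∈ hullOf S) :
    (M : ℝ) ≤ q * x.1 + p * x.2 := by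
  have hp' : (0 : ℝ) < p := by exact_mod_cast hp
  have := le_weight_of_mem_hullOf (t := q / p) (m := M / p) (by positivity) (fun a ha => ?_) hx
  · rw [weight_apply, div_le_iff₀ hp'] at this
    field_simp at this
    linarith
  · have h := hM a ha
    rw [weight_apply, div_le_iff₀ hp']
    simp only [toPlane]
    field_simp
    exact_mod_cast h

theorem mem_face_iff {S : Set (ℕ × ℕ)} {q p M : ℕ} (hp : 0 < p)
    (hM : ∀ a ∈ S, M ≤ q * a.1 + p * a.2) (hM' : ∃ a ∈ S, q * a.1 + p * a.2 = M) {x : ℝ × ℝ} :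
    x ∈ face (hullOf S) q p ↔ x ∈ hullOf S ∧ (q : ℝ) * x.1 + p * x.2 = M := by
  constructor
  · rintro ⟨hx, h⟩
    obtain ⟨a, ha, haM⟩ := hM'
    refine ⟨hx, le_antisymm ?_ (le_of_mem_hullOf hp hM hx)⟩
    refine (h _ (toPlane_mem_hullOf ha)).trans_eq ?_
    simp only [toPlane]
    exact_mod_cast haM
  · rintro ⟨hx, h⟩
    exact ⟨hx, fun y hy => h.trans_le (le_of_mem_hullOf hp hM hy)⟩

theorem toPlane_mem_face {S : Set (ℕ × ℕ)} {q p M : ℕ} (hp : 0 < p)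
    (hM : ∀ a ∈ S, M ≤ q * a.1 + p * a.2) {a : ℕ × ℕ} (ha : a ∈ S) (haM : q * a.1 + p * a.2 = M) :
    toPlane a ∈ face (hullOf S) q p :=
  (mem_face_iff hp hM ⟨a, ha, haM⟩).2 ⟨toPlane_mem_hullOf ha, by
    simp only [toPlane]; exact_mod_cast haM⟩

theorem eq_of_toPlane_mem_face {S : Set (ℕ × ℕ)} {q p M : ℕ} (hp : 0 < p)
    (hM : ∀ a ∈ S, M ≤ q * a.1 + p * a.2) (hM' : ∃ a ∈ S, q * a.1 + p * a.2 = M) {a : ℕ × ℕ}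
    (ha : toPlane a ∈ face (hullOf S) q p) : q * a.1 + p * a.2 = M := by
  have := ((mem_face_iff hp hM hM').1 ha).2
  simp only [toPlane] at this
  exact_mod_cast this

theorem toPlane_injective : Function.Injective toPlane := fun a b h => by
  simp only [toPlane, Prod.mk.injEq, Nat.cast_inj] at h
  exact Prod.ext h.1 h.2

theorem isCompactEdge_face {N : Set (ℝ × ℝ)} {q p : ℕ} (hq : 0 < q) (hp : 0 < p)
    (h : (face N q p).Nontrivial) : IsCompactEdge N (face N q p) :=
  ⟨h, q, p, by exact_mod_cast hq, by exact_mod_cast hp, rfl⟩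

theorem edgePolynomial_face {P : Cz[X]} {d q p M : ℕ} (hp : 0 < p)
    (hM : ∀ a ∈ exponents P, M ≤ q * a.1 + p * a.2)
    (hM' : ∃ a ∈ exponents P, q * a.1 + p * a.2 = M)
    (hd : ∀ a ∈ exponents P, q * a.1 + p * a.2 = M → a.1 ≤ d) :
    edgePolynomial P (face (newtonPolygon P) q p) = ∑ a ∈ lineIndex d q p M,
      Polynomial.monomial a.1 (Polynomial.monomial a.2 (coeffAt P a.1 a.2)) := by
  refine finsum_mem_eq_sum_of_inter_support_eq _ ?_
  ext a
  simp only [Set.mem_inter_iff, Set.mem_ofPred_eq, Function.mem_support, Finset.mem_coe,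
    mem_lineIndex hp, newtonPolygon_eq, ne_eq, Polynomial.monomial_eq_zero_iff]
  constructor
  · rintro ⟨h1, h2⟩
    have := eq_of_toPlane_mem_face hp hM hM' h1
    exact ⟨⟨hd a h2 this, this⟩, h2⟩
  · rintro ⟨⟨-, h1⟩, h2⟩
    exact ⟨toPlane_mem_face hp hM h2 h1, h2⟩

/-- Quasi-homogeneity: on the curve $(\tau^p,c\tau^q)$ the monomial $z_1^iz_2^j$ becomes
$c^j\tau^{qj+pi}$, and $qj+pi=M$ on the face. -/
theorem evalEval_edgePolynomial_face {P : Cz[X]} {d q p M : ℕ} (hp : 0 < p)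
    (hM : ∀ a ∈ exponents P, M ≤ q * a.1 + p * a.2)
    (hM' : ∃ a ∈ exponents P, q * a.1 + p * a.2 = M)
    (hd : ∀ a ∈ exponents P, q * a.1 + p * a.2 = M → a.1 ≤ d) (c τ : ℂ) :
    (edgePolynomial P (face (newtonPolygon P) q p)).evalEval (τ ^ p) (c * τ ^ q) =
      τ ^ M * (linePoly P d q p M).eval c := by
  rw [edgePolynomial_face hp hM hM' hd, linePoly, Polynomial.eval_finsetSum, Finset.mul_sum,
    Polynomial.evalEval, Polynomial.eval_finsetSum, Polynomial.eval_finsetSum]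
  refine Finset.sum_congr rfl fun a ha => ?_
  rw [← ((mem_lineIndex hp).1 ha).2]
  simp only [Polynomial.eval_monomial, Polynomial.eval_mul, Polynomial.eval_pow, Polynomial.eval_C]
  ring

/-! ### Roots and face polynomials -/

section

variable {L : Type*} [Field L] {φ : PowerSeries ℂ →+* L} {v : AbsoluteValue L ℝ} {ρ : ℝ}

theorem IsAdicExtension.sum_le (H : IsAdicExtension φ v ρ) {ι : Type*} (s : Finset ι) (f : ι → L)
    {B : ℝ} (hB : 0 ≤ B) (h : ∀ i ∈ s, v (f i) ≤ B) : v (∑ i ∈ s, f i) ≤ B := by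
  refine Finset.sum_induction f (fun x => v x ≤ B) (fun a b ha hb => ?_) (by simpa using hB) h
  exact (H.nonarch a b).trans (max_le ha hb)

theorem IsAdicExtension.uniformizer_lt_one (H : IsAdicExtension φ v ρ) {ζ : L} {p : ℕ}
    (hζ : ζ ^ p = φ PowerSeries.X) : v ζ < 1 := by
  by_contra! h
  have := one_le_pow₀ (n := p) h
  rw [← map_pow, hζ, H.map_X] at this
  exact absurd H.lt_one this.not_gt

/-- Used with $f$ the coefficient of $z_2^j$ and $k=qj$: modulo $\zeta^{M+1}$ only the coefficient
on the line survives. The filtered sum has at most one term, and none if the line misses the lattice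
in this column. -/
theorem IsAdicExtension.sub_leading_le (H : IsAdicExtension φ v ρ) {ζ : L} {p : ℕ} (hp : 0 < p)
    (hζ : ζ ^ p = φ PowerSeries.X) {f : PowerSeries ℂ} {k M : ℕ}
    (hf : ∀ i, PowerSeries.coeff i f ≠ 0 → M ≤ k + p * i) :
    v (φ f * ζ ^ k - ζ ^ M * φ (PowerSeries.C (∑ i ∈ (Finset.range (M + 1)).filter
      fun i => k + p * i = M, PowerSeries.coeff i f))) ≤ v ζ ^ (M + 1) := by
  have hζ1 := (H.uniformizer_lt_one hζ).le
  have hρ : ρ = v ζ ^ p := by rw [← map_pow, hζ, H.map_X]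
  by_cases h : ∃ i, k + p * i = M
  · obtain ⟨i, rfl⟩ := h
    have hfil : (Finset.range (k + p * i + 1)).filter (fun i' => k + p * i' = k + p * i) = {i} := by
      ext i'
      simp only [Finset.mem_filter, Finset.mem_range, Finset.mem_singleton]
      constructor
      · rintro ⟨-, h⟩
        exact Nat.eq_of_mul_eq_mul_left hp (by omega)
      · rintro rfl
        have : i' ≤ p * i' := Nat.le_mul_of_pos_left _ hp
        exact ⟨by omega, rfl⟩
    rw [hfil, Finset.sum_singleton]
    set c := PowerSeries.coeff i f with hc
    have heq : φ f * ζ ^ k - ζ ^ (k + p * i) * φ (PowerSeries.C c) =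
        φ (f - PowerSeries.C c * PowerSeries.X ^ i) * ζ ^ k := by
      rw [map_sub, map_mul, map_pow, ← hζ]
      ring
    have hle : v (φ (f - PowerSeries.C c * PowerSeries.X ^ i)) ≤ ρ ^ (i + 1) := by
      refine H.le_pow fun j hj => ?_
      rw [map_sub, PowerSeries.coeff_C_mul, PowerSeries.coeff_X_pow]
      split_ifs with hji
      · rw [hji, mul_one, ← hc, sub_self]
      · rw [mul_zero, sub_zero]
        by_contra h0
        have := hf j h0
        have := Nat.le_of_mul_le_mul_left (show p * i ≤ p * j by omega) hp
        omega
    rw [heq, map_mul, map_pow]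
    calc _ ≤ ρ ^ (i + 1) * v ζ ^ k := by gcongr
      _ = v ζ ^ (p * (i + 1) + k) := by rw [hρ, ← pow_mul, pow_add]
      _ ≤ _ := pow_le_pow_of_le_one (v.nonneg _) hζ1 (by rw [mul_add]; omega)
  · push Not at h
    rw [Finset.filter_false_of_mem fun i _ => h i, Finset.sum_empty, map_zero, map_zero, mul_zero,
      sub_zero, map_mul, map_pow]
    by_cases hf0 : f = 0
    · rw [hf0, map_zero, map_zero, zero_mul]
      positivity
    obtain ⟨i, hi, -, hv⟩ := H.exists_eq_pow hf0
    have h1 := hf i hi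
    have h2 := h i
    rw [hv, hρ, ← pow_mul, ← pow_add]
    exact pow_le_pow_of_le_one (v.nonneg _) hζ1 (by omega)

theorem eval₂_linePoly {A : Type*} [CommSemiring A] (P : Cz[X]) (d q p M : ℕ) (ψ : ℂ →+* A) (ξ : A) :
    (linePoly P d q p M).eval₂ ψ ξ = ∑ j ∈ Finset.range (d + 1),
      ψ (∑ i ∈ (Finset.range (M + 1)).filter (fun i => q * j + p * i = M), coeffAt P j i) * ξ ^ j := by
  rw [linePoly, lineIndex, Polynomial.eval₂_finsetSum, Finset.sum_filter, Finset.sum_product]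
  refine Finset.sum_congr rfl fun j _ => ?_
  rw [Finset.sum_filter, map_sum, Finset.sum_mul]
  refine Finset.sum_congr rfl fun i _ => ?_
  split_ifs
  · rw [Polynomial.eval₂_monomial]
  · rw [map_zero, zero_mul]

/-- Dividing $P(\xi\zeta^q)=0$ by $\zeta^M$ leaves the line polynomial at $\xi$ plus a small error.
The inequality expresses, without a residue field, that $\xi$ reduces to a root. -/
theorem IsAdicExtension.eval₂_linePoly_lt_one (H : IsAdicExtension φ v ρ) {P : Cz[X]} {α ζ ξ : L}
    {q p M : ℕ} (hα : (P.map (restrictCz φ)).IsRoot α) (hp : 0 < p)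
    (hζ : ζ ^ p = φ PowerSeries.X) (hξ : α = ξ * ζ ^ q) (hξ1 : v ξ ≤ 1)
    (hM : ∀ a ∈ exponents P, M ≤ q * a.1 + p * a.2) :
    v ((linePoly P P.natDegree q p M).eval₂ (φ.comp PowerSeries.C) ξ) < 1 := by
  refine lt_of_le_of_lt ?_ (H.uniformizer_lt_one hζ)
  have hζ0 : 0 < v ζ := by
    refine v.pos ?_
    rintro rfl
    rw [zero_pow hp.ne'] at hζ
    have := H.map_X
    rw [← hζ, map_zero] at this
    exact H.pos.ne this
  have key : ζ ^ M * (linePoly P P.natDegree q p M).eval₂ (φ.comp PowerSeries.C) ξ =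
      -∑ j ∈ Finset.range (P.natDegree + 1), (φ (P.coeff j : PowerSeries ℂ) * ζ ^ (q * j) -
        ζ ^ M * φ (PowerSeries.C (∑ i ∈ (Finset.range (M + 1)).filter
          fun i => q * j + p * i = M, PowerSeries.coeff i (P.coeff j : PowerSeries ℂ)))) * ξ ^ j := by
    rw [Polynomial.IsRoot, Polynomial.eval_map, Polynomial.eval₂_eq_sum_range] at hα
    rw [eval₂_linePoly, Finset.mul_sum, eq_neg_iff_add_eq_zero, ← Finset.sum_add_distrib, ← hα]
    refine Finset.sum_congr rfl fun j _ => ?_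
    rw [restrictCz_apply, hξ, RingHom.comp_apply]
    simp only [coeffAt]
    ring
  have hle := H.sum_le (Finset.range (P.natDegree + 1)) (fun j =>
    (φ (P.coeff j : PowerSeries ℂ) * ζ ^ (q * j) -
        ζ ^ M * φ (PowerSeries.C (∑ i ∈ (Finset.range (M + 1)).filter
          fun i => q * j + p * i = M, PowerSeries.coeff i (P.coeff j : PowerSeries ℂ)))) * ξ ^ j)
    (B := v ζ ^ (M + 1)) (by positivity) fun j _ => by
      rw [map_mul, map_pow]
      exact (mul_le_of_le_one_right (v.nonneg _) (pow_le_one₀ (v.nonneg _) hξ1)).trans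
        (H.sub_leading_le hp hζ fun i hi => hM (j, i) hi)
  rw [← v.map_neg, ← key, map_mul, map_pow, pow_succ] at hle
  exact le_of_mul_le_mul_left hle (pow_pos hζ0 M)

theorem IsAdicExtension.eval₂_le_one (H : IsAdicExtension φ v ρ) (f : ℂ[X]) {ξ : L} (hξ : v ξ ≤ 1) :
    v (f.eval₂ (φ.comp PowerSeries.C) ξ) ≤ 1 := by
  rw [Polynomial.eval₂_eq_sum_range]
  refine H.sum_le _ _ zero_le_one fun i _ => ?_
  rw [map_mul, map_pow]
  exact mul_le_one₀ (H.le_one _) (by positivity) (pow_le_one₀ (v.nonneg _) hξ)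

theorem IsAdicExtension.eval₂_sub_lt_one (H : IsAdicExtension φ v ρ) (f : ℂ[X]) {ξ η : L}
    (hξ : v ξ ≤ 1) (hη : v η ≤ 1) (h : v (ξ - η) < 1) :
    v (f.eval₂ (φ.comp PowerSeries.C) ξ - f.eval₂ (φ.comp PowerSeries.C) η) < 1 := by
  refine lt_of_le_of_lt ?_ h
  rw [Polynomial.eval₂_eq_sum_range, Polynomial.eval₂_eq_sum_range, ← Finset.sum_sub_distrib]
  refine H.sum_le _ _ (v.nonneg _) fun i hi => ?_
  clear hi
  rw [← mul_sub, map_mul]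
  refine (mul_le_of_le_one_left (v.nonneg _) (H.le_one _)).trans ?_
  induction i with
  | zero => simp
  | succ i ih =>
    have : ξ ^ (i + 1) - η ^ (i + 1) = ξ * (ξ ^ i - η ^ i) + (ξ - η) * η ^ i := by ring
    rw [this]
    refine (H.nonarch _ _).trans (max_le ?_ ?_)
    · rw [map_mul]
      exact (mul_le_of_le_one_left (v.nonneg _) hξ).trans ih
    · rw [map_mul, map_pow]
      exact mul_le_of_le_one_right (v.nonneg _) (pow_le_one₀ (v.nonneg _) hη)

/-- The gcd has no root other than 0, so over $\mathbf C$ it is a constant times a power of $X$;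
Bézout gives the identity. -/
theorem exists_X_pow_eq {f g : ℂ[X]} (h : ∀ c, f.IsRoot c → g.IsRoot c → c = 0) :
    ∃ (a b : ℂ[X]) (n : ℕ), a * f + b * g = Polynomial.X ^ n := by
  classical
  set d := EuclideanDomain.gcd f g with hd
  have hdr : ∀ c, d.IsRoot c → c = 0 := fun c hc =>
    h c (hc.dvd (EuclideanDomain.gcd_dvd_left f g)) (hc.dvd (EuclideanDomain.gcd_dvd_right f g))
  have hd0 : d ≠ 0 := fun h0 => one_ne_zero (hdr 1 (by simp [h0]))
  have hroots : d.roots = Multiset.replicate (Multiset.card d.roots) 0 :=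
    Multiset.eq_replicate_card.2 fun c hc => hdr c (Polynomial.isRoot_of_mem_roots hc)
  have hX : d = Polynomial.C d.leadingCoeff * Polynomial.X ^ Multiset.card d.roots := by
    conv_lhs => rw [(IsAlgClosed.splits d).eq_prod_roots, hroots]
    simp
  have hlc : d.leadingCoeff ≠ 0 := Polynomial.leadingCoeff_ne_zero.2 hd0
  refine ⟨Polynomial.C d.leadingCoeff⁻¹ * EuclideanDomain.gcdA f g,
    Polynomial.C d.leadingCoeff⁻¹ * EuclideanDomain.gcdB f g, Multiset.card d.roots, ?_⟩
  have hb : d = f * EuclideanDomain.gcdA f g + g * EuclideanDomain.gcdB f g :=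
    EuclideanDomain.gcd_eq_gcd_ab f g
  calc _ = Polynomial.C d.leadingCoeff⁻¹ *
        (f * EuclideanDomain.gcdA f g + g * EuclideanDomain.gcdB f g) := by ring
    _ = Polynomial.C d.leadingCoeff⁻¹ * d := by rw [← hb]
    _ = Polynomial.C d.leadingCoeff⁻¹ *
        (Polynomial.C d.leadingCoeff * Polynomial.X ^ Multiset.card d.roots) := congrArg _ hX
    _ = _ := by
      rw [← mul_assoc, ← Polynomial.C_mul, inv_mul_cancel₀ hlc, Polynomial.C_1, one_mul]

/-- If $\xi$ and $\eta$ were congruent, $f$ and $g$ would both be small at $\xi$, hence so would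
$\xi^n=af+bg$, against $|\xi|=1$. -/
theorem IsAdicExtension.one_le_sub (H : IsAdicExtension φ v ρ) {f g : ℂ[X]}
    (h : ∀ c, f.IsRoot c → g.IsRoot c → c = 0) {ξ η : L} (hξ : v ξ = 1) (hη : v η = 1)
    (hf : v (f.eval₂ (φ.comp PowerSeries.C) ξ) < 1)
    (hg : v (g.eval₂ (φ.comp PowerSeries.C) η) < 1) : 1 ≤ v (ξ - η) := by
  by_contra! hlt
  obtain ⟨a, b, n, hab⟩ := exists_X_pow_eq h
  have hg' : v (g.eval₂ (φ.comp PowerSeries.C) ξ) < 1 := by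
    have := H.nonarch (g.eval₂ (φ.comp PowerSeries.C) ξ - g.eval₂ (φ.comp PowerSeries.C) η)
      (g.eval₂ (φ.comp PowerSeries.C) η)
    rw [sub_add_cancel] at this
    exact this.trans_lt (max_lt (H.eval₂_sub_lt_one g hξ.le hη.le hlt) hg)
  have h1 : v ((a * f + b * g).eval₂ (φ.comp PowerSeries.C) ξ) < 1 := by
    rw [Polynomial.eval₂_add, Polynomial.eval₂_mul, Polynomial.eval₂_mul]
    refine (H.nonarch _ _).trans_lt (max_lt ?_ ?_)
    · rw [map_mul]
      exact (mul_le_of_le_one_left (v.nonneg _) (H.eval₂_le_one a hξ.le)).trans_lt hf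
    · rw [map_mul]
      exact (mul_le_of_le_one_left (v.nonneg _) (H.eval₂_le_one b hξ.le)).trans_lt hg'
  rw [hab, Polynomial.eval₂_pow, Polynomial.eval₂_X, map_pow, hξ, one_pow] at h1
  exact lt_irrefl _ h1

end

/-! ### Common zeros of edge polynomials of parallel edges -/

/-- Every point off the axes lies on a curve $(\tau^p,c\tau^q)$ with $c\ne0$, and each such curve
tends to the origin. Whether the edge polynomials vanish there depends on $c$ alone, so the local
condition is a global one. -/
theorem eventually_not_common_zero_iff {P Q : Cz[X]} {d d' q p M M' : ℕ} (hq : 0 < q) (hp : 0 < p)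
    (hM : ∀ a ∈ exponents P, M ≤ q * a.1 + p * a.2)
    (hM' : ∃ a ∈ exponents P, q * a.1 + p * a.2 = M)
    (hd : ∀ a ∈ exponents P, q * a.1 + p * a.2 = M → a.1 ≤ d)
    (hN : ∀ a ∈ exponents Q, M' ≤ q * a.1 + p * a.2)
    (hN' : ∃ a ∈ exponents Q, q * a.1 + p * a.2 = M')
    (he : ∀ a ∈ exponents Q, q * a.1 + p * a.2 = M' → a.1 ≤ d') :
    (∀ᶠ z : ℂ × ℂ in 𝓝 0, z.1 ≠ 0 → z.2 ≠ 0 →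
      ¬ ((edgePolynomial P (face (newtonPolygon P) q p)).evalEval z.1 z.2 = 0 ∧
        (edgePolynomial Q (face (newtonPolygon Q) q p)).evalEval z.1 z.2 = 0)) ↔
    ∀ c, (linePoly P d q p M).IsRoot c → (linePoly Q d' q p M').IsRoot c → c = 0 := by
  constructor
  · intro h c h1 h2
    by_contra hc
    have ht : Filter.Tendsto (fun τ : ℂ => (τ ^ p, c * τ ^ q)) (𝓝 0) (𝓝 0) := by
      have : Continuous fun τ : ℂ => (τ ^ p, c * τ ^ q) := by fun_prop
      simpa [hp.ne', hq.ne', Prod.zero_eq_mk] using this.tendsto 0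
    have hev := (ht.mono_left (nhdsWithin_le_nhds (s := {0}ᶜ))).eventually h
    obtain ⟨τ, hτ, hτ0⟩ := (hev.and (self_mem_nhdsWithin (a := (0 : ℂ)) (s := {0}ᶜ))).exists
    refine hτ (pow_ne_zero _ hτ0) (mul_ne_zero hc (pow_ne_zero _ hτ0)) ⟨?_, ?_⟩
    · rw [evalEval_edgePolynomial_face hp hM hM' hd, h1.eq_zero, mul_zero]
    · rw [evalEval_edgePolynomial_face hp hN hN' he, h2.eq_zero, mul_zero]
  · intro h
    refine Filter.Eventually.of_forall fun z hz1 hz2 hz => ?_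
    obtain ⟨τ, hτ⟩ := IsAlgClosed.exists_pow_nat_eq z.1 hp
    have hτ0 : τ ≠ 0 := by
      rintro rfl
      exact hz1 (by rw [← hτ, zero_pow hp.ne'])
    have hz2' : z.2 = z.2 / τ ^ q * τ ^ q := (div_mul_cancel₀ _ (pow_ne_zero _ hτ0)).symm
    rw [← hτ, hz2', evalEval_edgePolynomial_face hp hM hM' hd,
      evalEval_edgePolynomial_face hp hN hN' he] at hz
    have h1 := (mul_eq_zero.1 hz.1).resolve_left (pow_ne_zero _ hτ0)
    have h2 := (mul_eq_zero.1 hz.2).resolve_left (pow_ne_zero _ hτ0)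
    have := h _ h1 h2
    rw [this, zero_mul] at hz2'
    exact hz2 hz2'

/-- $P(0,z_2)$ is the line polynomial of the horizontal axis, so roots of order 0 are handled like
the others. -/
theorem linePoly_zero_one_zero (P : Cz[X]) : linePoly P P.natDegree 0 1 0 = atZero P := by
  have h := eval₂_linePoly P P.natDegree 0 1 0 (Polynomial.C (R := ℂ)) Polynomial.X
  have hf : (Finset.range (0 + 1)).filter (fun i => 1 * i = 0) = {0} := by
    ext i
    simp only [Finset.mem_filter, Finset.mem_range, Finset.mem_singleton]
    omega
  simp only [zero_mul, zero_add, Polynomial.eval₂_C_X] at h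
  rw [h, Polynomial.as_sum_range_C_mul_X_pow' (atZero P)
    (Nat.lt_succ_of_le (Polynomial.natDegree_map_le (p := P)))]
  refine Finset.sum_congr rfl fun j _ => ?_
  rw [show (Finset.range 1).filter (fun i => 1 * i = 0) = {0} from hf, Finset.sum_singleton,
    atZero, Polynomial.coeff_map]
  simp [coeffAt]

theorem le_natDegree_of_mem_exponents {P : Cz[X]} {a : ℕ × ℕ} (ha : a ∈ exponents P) :
    a.1 ≤ P.natDegree :=
  Polynomial.le_natDegree_of_ne_zero fun h => ha (by simp [coeffAt, h])

/-! ### Differences of roots in general position -/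

theorem exists_face_level {S : Set (ℕ × ℕ)} {r : ℝ} {a b : ℕ × ℕ} (ha : a ∈ S) (hb : b ∈ S)
    (hab : a ≠ b) (hwab : weight r (toPlane a) = weight r (toPlane b))
    (h : ∀ c ∈ S, weight r (toPlane a) ≤ weight r (toPlane c)) {q p : ℕ} (hp : 0 < p)
    (hq : (q : ℝ) = p * r) :
    ∃ M, (∀ c ∈ S, M ≤ q * c.1 + p * c.2) ∧ (∃ c ∈ S, q * c.1 + p * c.2 = M) ∧
      (face (hullOf S) q p).Nontrivial := by
  have hw : ∀ c : ℕ × ℕ, ((q * c.1 + p * c.2 : ℕ) : ℝ) = p * weight r (toPlane c) := fun c => by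
    push_cast
    rw [hq]
    simp only [weight_apply, toPlane]
    ring
  have hM : ∀ c ∈ S, q * a.1 + p * a.2 ≤ q * c.1 + p * c.2 := fun c hc => by
    have : ((q * a.1 + p * a.2 : ℕ) : ℝ) ≤ (q * c.1 + p * c.2 : ℕ) := by
      rw [hw, hw]
      exact mul_le_mul_of_nonneg_left (h c hc) (Nat.cast_nonneg _)
    exact_mod_cast this
  have hb' : q * b.1 + p * b.2 = q * a.1 + p * a.2 := by
    have : ((q * b.1 + p * b.2 : ℕ) : ℝ) = (q * a.1 + p * a.2 : ℕ) := by rw [hw, hw, hwab]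
    exact_mod_cast this
  exact ⟨_, hM, ⟨a, ha, rfl⟩, _, toPlane_mem_face hp hM ha rfl, _, toPlane_mem_face hp hM hb hb',
    toPlane_injective.ne hab⟩

section

variable {L : Type*} [Field L] [IsAlgClosed L] {φ : PowerSeries ℂ →+* L} {v : AbsoluteValue L ℝ}
  {ρ : ℝ}

/-- The order of a root has positive multiplicity among the slopes, so the edge given by
`exists_edge` has distinct ends, and its slope is height over length, hence rational. -/
theorem IsAdicExtension.exists_edge_of_root (H : IsAdicExtension φ v ρ) {P : Cz[X]} (hP : P.Monic)
    (h0 : ∃ k, (0, k) ∈ exponents P) {α : L} (hα : (P.map (restrictCz φ)).IsRoot α)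
    (hr : 0 < ordOf v ρ α) :
    (∃ q p : ℕ, 0 < q ∧ 0 < p ∧ (q : ℝ) = p * ordOf v ρ α) ∧
    ∃ a ∈ exponents P, ∃ b ∈ exponents P, a ≠ b ∧
      weight (ordOf v ρ α) (toPlane a) = weight (ordOf v ρ α) (toPlane b) ∧
      ∀ c ∈ exponents P, weight (ordOf v ρ α) (toPlane a) ≤ weight (ordOf v ρ α) (toPlane c) := by
  set r := ordOf v ρ α with hrdef
  set R := (P.map (restrictCz φ)).roots.map (ordOf v ρ) with hR
  have hS : ∀ t, 0 < t → IsLeast ((fun a => weight t (toPlane a)) '' exponents P)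
      (R.map fun x => min t x).sum := fun t _ => by
    rw [hR, Multiset.map_map]
    exact H.isLeast_roots hP h0 t
  have hc : 0 < R.count r := Multiset.count_pos.2
    (Multiset.mem_map_of_mem _ ((Polynomial.mem_roots (hP.map _).ne_zero).2 hα))
  obtain ⟨j, i, k, h1, h2, hk, hw⟩ := exists_edge hS hr
  refine ⟨⟨k, R.count r, ?_, hc, hk⟩, _, h2, _, h1, ?_, ?_, fun c hcS => ?_⟩
  · have : (0 : ℝ) < k := by rw [hk]; positivity
    exact_mod_cast this
  · intro h
    have := congrArg Prod.fst h
    simp only at this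
    omega
  · simp only [weight_apply, toPlane]
    push_cast
    rw [hk]
    ring
  · have := (hS r hr).2 ⟨c, hcS, rfl⟩
    rw [← hw] at this
    refine le_trans (le_of_eq ?_) this
    simp [toPlane]

theorem IsAdicExtension.map_sub_eq_max (H : IsAdicExtension φ v ρ) {P Q : Cz[X]} (hP : P.Monic)
    (hQ : Q.Monic) (hP0 : ∃ k, (0, k) ∈ exponents P) (hQ0 : ∃ k, (0, k) ∈ exponents Q)
    (h0 : ∀ c, (atZero P).IsRoot c → (atZero Q).IsRoot c → c = 0)
    (hE : EdgesInGeneralPosition (newtonPolygon P) (newtonPolygon Q) P Q) {α β : L}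
    (hα : (P.map (restrictCz φ)).IsRoot α) (hβ : (Q.map (restrictCz φ)).IsRoot β) :
    v (α - β) = max (v α) (v β) := by
  by_cases hne : v α = v β
  swap
  · rw [sub_eq_add_neg, H.nonarch.add_eq_max_of_ne (by rwa [v.map_neg]), v.map_neg]
  have hα0 := H.root_ne_zero hP0 hα
  refine le_antisymm ?_ ?_
  · have := H.nonarch α (-β)
    rwa [v.map_neg, ← sub_eq_add_neg] at this
  rw [← hne, max_self]
  have hord : ordOf v ρ β = ordOf v ρ α := by rw [ordOf, ordOf, hne]
  rcases (H.ordOf_nonneg hP hα).eq_or_lt with hr | hr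
  · have hv1 : v α = 1 := by rw [← H.rpow_ordOf hα0, ← hr, Real.rpow_zero]
    rw [hv1]
    refine H.one_le_sub h0 hv1 (hne ▸ hv1) ?_ ?_
    · rw [← linePoly_zero_one_zero]
      exact H.eval₂_linePoly_lt_one hα one_pos (pow_one _) (by simp) hv1.le fun _ _ => Nat.zero_le _
    · rw [← linePoly_zero_one_zero]
      exact H.eval₂_linePoly_lt_one hβ one_pos (pow_one _) (by simp) (hne ▸ hv1).le
        fun _ _ => Nat.zero_le _
  · obtain ⟨⟨q, p, hq, hp, hqp⟩, a, ha, b, hb, hab, hwab, hmin⟩ := H.exists_edge_of_root hP hP0 hα hr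
    obtain ⟨-, a', ha', b', hb', hab', hwab', hmin'⟩ :=
      H.exists_edge_of_root hQ hQ0 hβ (hord ▸ hr)
    obtain ⟨M, hM, hM', hnt⟩ := exists_face_level ha hb hab hwab hmin hp hqp
    -- The orders agree, so the same pair $(q,p)$ defines an edge of the second polygon.
    obtain ⟨M', hN, hN', hnt'⟩ := exists_face_level ha' hb' hab' hwab' hmin' hp (hord ▸ hqp)
    have hcommon := (eventually_not_common_zero_iff hq hp hM hM'
      (fun c hc _ => le_natDegree_of_mem_exponents hc) hN hN'
      (fun c hc _ => le_natDegree_of_mem_exponents hc)).1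
      (hE _ _ (isCompactEdge_face hq hp hnt) (isCompactEdge_face hq hp hnt'))
    obtain ⟨ζ, hζ⟩ := IsAlgClosed.exists_pow_nat_eq (φ PowerSeries.X) hp
    have hζq : v (ζ ^ q) = v α := by
      refine (pow_left_inj₀ (v.nonneg _) (v.nonneg _) hp.ne').1 ?_
      rw [← map_pow, ← pow_mul, mul_comm q, pow_mul, hζ, map_pow, H.map_X, ← H.rpow_ordOf hα0,
        ← Real.rpow_natCast, ← Real.rpow_natCast, ← Real.rpow_mul H.pos.le, hqp, mul_comm]
    have hζ0 : ζ ^ q ≠ 0 := v.ne_zero_iff.1 (by rw [hζq]; exact v.ne_zero hα0)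
    have hξ : v (α / ζ ^ q) = 1 := by rw [map_div₀, hζq, div_self (v.ne_zero hα0)]
    have hη : v (β / ζ ^ q) = 1 := by rw [map_div₀, hζq, ← hne, div_self (v.ne_zero hα0)]
    have := H.one_le_sub hcommon hξ hη
      (H.eval₂_linePoly_lt_one hα hp hζ (div_mul_cancel₀ _ hζ0).symm hξ.le hM)
      (H.eval₂_linePoly_lt_one hβ hp hζ (div_mul_cancel₀ _ hζ0).symm hη.le hN)
    rwa [← sub_div, map_div₀, hζq, one_le_div (v.pos hα0)] at this

end

theorem newtonPolygon_resultantPoly {P Q : Cz[X]} (hP : P.Monic) (hQ : Q.Monic)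
    (hP0 : ∃ k, (0, k) ∈ exponents P) (hQ0 : ∃ k, (0, k) ∈ exponents Q)
    (h0 : ∀ c, (atZero P).IsRoot c → (atZero Q).IsRoot c → c = 0)
    (hE : EdgesInGeneralPosition (newtonPolygon P) (newtonPolygon Q) P Q) :
    newtonPolygon (resultantPoly P Q) = polygonMul (newtonPolygon P) (newtonPolygon Q) := by
  obtain ⟨L, _, _, φ, v, hv, hle, hpos, hlt⟩ := exists_isAlgClosed_absoluteValue
  have H : IsAdicExtension φ v (v (φ PowerSeries.X)) := ⟨hv, hle, rfl, hpos, hlt⟩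
  have hnn : ∀ {P : Cz[X]}, P.Monic → ∀ r ∈ (P.map (restrictCz φ)).roots.map
      (ordOf v (v (φ PowerSeries.X))), 0 ≤ r := fun hP r hr => by
    obtain ⟨α, hα, rfl⟩ := Multiset.mem_map.1 hr
    exact H.ordOf_nonneg hP (Polynomial.isRoot_of_mem_roots hα)
  refine hullOf_eq_polygonMul (hnn hP) (hnn hQ) (fun t _ => ?_) (fun t _ => ?_) (fun t _ => ?_)
  · rw [Multiset.map_map]
    exact H.isLeast_roots hP hP0 t
  · rw [Multiset.map_map]
    exact H.isLeast_roots hQ hQ0 t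
  · simp only [Multiset.map_map, Function.comp_apply]
    exact H.isLeast_resultantPoly hP hQ hP0 hQ0
      (fun α β hα hβ => H.map_sub_eq_max hP hQ hP0 hQ0 h0 hE hα hβ) t

/-! ### The combinatorics of compact edges -/

theorem face_eq_face {N : Set (ℝ × ℝ)} {q p q' p' : ℕ} (hp : 0 < p) (hp' : 0 < p')
    (h : q * p' = q' * p) : face N q p = face N q' p' := by
  have key : ∀ {q p q' p' : ℕ}, 0 < p → 0 < p' → q * p' = q' * p → face N q p ⊆ face N q' p' := by
    intro q p q' p' hp hp' h x hx
    refine ⟨hx.1, fun y hy => ?_⟩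
    have hp0 : (0 : ℝ) < p := by exact_mod_cast hp
    have hh : (q : ℝ) * p' = q' * p := by exact_mod_cast h
    have hx2 := mul_le_mul_of_nonneg_left (hx.2 y hy) (Nat.cast_nonneg (α := ℝ) p')
    refine le_of_mul_le_mul_left ?_ hp0
    calc (p : ℝ) * (q' * x.1 + p' * x.2) = p' * (q * x.1 + p * x.2) := by
          linear_combination (-x.1) * hh
      _ ≤ p' * (q * y.1 + p * y.2) := hx2
      _ = p * (q' * y.1 + p' * y.2) := by linear_combination y.1 * hh
  exact subset_antisymm (key hp hp' h) (key hp' hp h.symm)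

/-- As $t>0$, a nonzero translation by $\mathbf N^2$ strictly increases the weight, so only
exponents themselves generate the face. -/
theorem mem_convexHull_of_weight_eq {T : Set (ℕ × ℕ)} {t m : ℝ} (ht : 0 < t)
    (hm : ∀ c ∈ T, m ≤ weight t (toPlane c)) {x : ℝ × ℝ} (hx : x ∈ hullOf T)
    (hxm : weight t x = m) :
    x ∈ convexHull ℝ (toPlane '' {c ∈ T | weight t (toPlane c) = m}) := by
  have hadd : ∀ a b : ℕ × ℕ, weight t (toPlane (a + b)) =
      weight t (toPlane a) + (t * b.1 + b.2) := fun a b => by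
    simp only [weight_apply, toPlane, Prod.fst_add, Prod.snd_add]
    push_cast
    ring
  refine convexHull_mono ?_ (mem_convexHull_inter_of_eq (weight t) ?_ hx hxm)
  · rintro _ ⟨⟨a, ha, b, rfl⟩, hab⟩
    simp only [Set.mem_ofPred_eq, hadd] at hab
    have h1 := hm a ha
    have h2 : 0 ≤ t * (b.1 : ℝ) := by positivity
    have h3 : (0 : ℝ) ≤ b.2 := Nat.cast_nonneg _
    have hb2 : (b.2 : ℝ) = 0 := by linarith
    have hb1 : t * (b.1 : ℝ) = 0 := by linarith
    have hb : b = 0 := by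
      refine Prod.ext ?_ (by exact_mod_cast hb2)
      rcases mul_eq_zero.1 hb1 with h | h
      · exact absurd h ht.ne'
      · exact_mod_cast h
    subst hb
    exact ⟨a, ⟨ha, by linarith⟩, by simp⟩
  · rintro _ ⟨a, ha, b, rfl⟩
    rw [hadd]
    have h2 : 0 ≤ t * (b.1 : ℝ) := by positivity
    have h3 : (0 : ℝ) ≤ b.2 := Nat.cast_nonneg _
    linarith [hm a ha]

/-- `γ` is the face of `N` on the line `q * x + p * y = M`, with end points `a` and `b`. The end
points are exponents of every power series with Newton polygon `N`. -/
structure IsEdgeWith (N γ : Set (ℝ × ℝ)) (q p M : ℕ) (a b : ℕ × ℕ) : Prop where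
  q_pos : 0 < q
  p_pos : 0 < p
  eq_face : γ = face N q p
  lt : a.1 < b.1
  le : ∀ T, hullOf T = N → ∀ c ∈ T, M ≤ q * c.1 + p * c.2
  left_mem : ∀ T, hullOf T = N → a ∈ T
  right_mem : ∀ T, hullOf T = N → b ∈ T
  left_eq : q * a.1 + p * a.2 = M
  right_eq : q * b.1 + p * b.2 = M
  between : ∀ c, toPlane c ∈ γ → a.1 ≤ c.1 ∧ c.1 ≤ b.1

/-- The ends of the edge are taken as the leftmost and rightmost exponents of `S` on it; they are
extreme points, hence belong to every generating set. -/
theorem exists_isEdgeWith {S : Set (ℕ × ℕ)} {γ : Set (ℝ × ℝ)} (h : IsCompactEdge (hullOf S) γ) :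
    ∃ q p M a b, IsEdgeWith (hullOf S) γ q p M a b := by
  obtain ⟨hnt, u, v, hu, hv, hγ⟩ := h
  set t := u / v with ht
  have ht0 : 0 < t := div_pos hu hv
  have huv : ∀ x : ℝ × ℝ, u * x.1 + v * x.2 = v * weight t x := fun x => by
    rw [weight_apply, ht]
    field_simp
  obtain ⟨x₀, hx₀⟩ := hnt.nonempty
  set m := weight t x₀ with hm
  have hmin : ∀ y ∈ hullOf S, m ≤ weight t y := fun y hy => by
    rw [hγ] at hx₀
    have := hx₀.2 y hy
    rw [huv, huv] at this
    exact le_of_mul_le_mul_left this hv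
  have hγ' : ∀ x, x ∈ γ ↔ x ∈ hullOf S ∧ weight t x = m := by
    rw [hγ] at hx₀
    intro x
    rw [hγ]
    constructor
    · rintro ⟨hx, h⟩
      refine ⟨hx, le_antisymm ?_ (hmin x hx)⟩
      have := h x₀ hx₀.1
      rw [huv, huv] at this
      exact le_of_mul_le_mul_left this hv
    · rintro ⟨hx, h⟩
      refine ⟨hx, fun y hy => ?_⟩
      rw [huv, huv, h]
      exact mul_le_mul_of_nonneg_left (hmin y hy) hv.le
  have hhull : ∀ T, hullOf T = hullOf S → ∀ x ∈ γ,
      x ∈ convexHull ℝ (toPlane '' {c ∈ T | weight t (toPlane c) = m}) := fun T hT x hx => by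
    obtain ⟨hx, hxm⟩ := (hγ' x).1 hx
    exact mem_convexHull_of_weight_eq ht0 (fun c hc => hmin _ (hT ▸ toPlane_mem_hullOf hc))
      (hT ▸ hx) hxm
  have hSnt : {c ∈ S | weight t (toPlane c) = m}.Nontrivial := by
    by_contra hns
    rw [Set.not_nontrivial_iff] at hns
    obtain ⟨x, hx, y, hy, hxy⟩ := hnt
    have hx' := hhull S rfl x hx
    have hy' := hhull S rfl y hy
    rcases (hns.image toPlane).eq_empty_or_singleton with h | ⟨z, h⟩
    · rw [h, convexHull_empty] at hx'
      exact hx'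
    · rw [h, convexHull_singleton, Set.mem_singleton_iff] at hx' hy'
      exact hxy (hx'.trans hy'.symm)
  have hle1 : ∀ c ∈ {c ∈ S | weight t (toPlane c) = m}, c.1 ≤ ⌊m / t⌋₊ := fun c hc => by
    refine Nat.le_floor ?_
    rw [le_div_iff₀ ht0, ← hc.2, weight_apply, mul_comm]
    simp only [toPlane]
    linarith [Nat.cast_nonneg (α := ℝ) c.2]
  have hsnd : ∀ c d : ℕ × ℕ, weight t (toPlane c) = m → weight t (toPlane d) = m → c.1 = d.1 →
      c = d := fun c d hc hd hcd => by
    refine Prod.ext hcd ?_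
    rw [← hd] at hc
    simp only [weight_apply, toPlane, hcd, add_right_inj, Nat.cast_inj] at hc
    exact hc
  have hfin : {c ∈ S | weight t (toPlane c) = m}.Finite := by
    refine Set.Finite.of_finite_image ((Set.finite_Iic ⌊m / t⌋₊).subset ?_)
      (f := Prod.fst) (fun c hc d hd hcd => hsnd c d hc.2 hd.2 hcd)
    rintro _ ⟨c, hc, rfl⟩
    exact hle1 c hc
  obtain ⟨a, ha, hamin⟩ := Set.exists_min_image _ Prod.fst hfin hSnt.nonempty
  obtain ⟨b, hb, hbmax⟩ := Set.exists_max_image _ Prod.fst hfin hSnt.nonempty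
  have hlt : a.1 < b.1 := by
    refine lt_of_le_of_ne (hamin b hb) fun hab => ?_
    obtain ⟨c, hc, d, hd, hcd⟩ := hSnt
    refine hcd (hsnd c d hc.2 hd.2 ?_)
    have := hamin c hc
    have := hamin d hd
    have := hbmax c hc
    have := hbmax d hd
    omega
  have hbet : ∀ x ∈ γ, (a.1 : ℝ) ≤ x.1 ∧ x.1 ≤ b.1 := fun x hx => by
    have hc : Convex ℝ {x : ℝ × ℝ | (a.1 : ℝ) ≤ x.1 ∧ x.1 ≤ b.1} :=
      (convex_halfSpace_ge (LinearMap.fst ℝ ℝ ℝ).isLinear (a.1 : ℝ)).inter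
        (convex_halfSpace_le (LinearMap.fst ℝ ℝ ℝ).isLinear (b.1 : ℝ))
    refine convexHull_min ?_ hc (hhull S rfl x hx)
    rintro _ ⟨c, hc, rfl⟩
    exact ⟨Nat.cast_le.2 (hamin c hc), Nat.cast_le.2 (hbmax c hc)⟩
  have hmemγ : ∀ T, hullOf T = hullOf S → ∀ c ∈ T, weight t (toPlane c) = m → toPlane c ∈ γ :=
    fun T hT c hc hcm => (hγ' _).2 ⟨hT ▸ toPlane_mem_hullOf hc, hcm⟩
  -- The face lies in the hull of the exponents of `T` on it. Where $f$ is minimal, one of these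
  -- must occur, and injectivity identifies it with `e`.
  have hends : ∀ (f : (ℝ × ℝ) →ₗ[ℝ] ℝ) (e : ℕ × ℕ), e ∈ S → weight t (toPlane e) = m →
      (∀ x ∈ γ, f (toPlane e) ≤ f x) →
      (∀ c : ℕ × ℕ, f (toPlane c) = f (toPlane e) → c.1 = e.1) →
      ∀ T, hullOf T = hullOf S → e ∈ T := by
    intro f e he hem hf hinj T hT
    have h1 := hhull T hT _ (hmemγ S rfl e he hem)
    have h2 := mem_convexHull_inter_of_eq f (m := f (toPlane e)) (fun x hx => ?_) h1 rfl
    · obtain ⟨_, ⟨c, hc, rfl⟩, hce⟩ := convexHull_nonempty_iff.1 ⟨_, h2⟩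
      have := hsnd c e hc.2 hem (hinj c hce)
      exact this ▸ hc.1
    · obtain ⟨c, hc, rfl⟩ := hx
      exact hf _ (hmemγ T hT c hc.1 hc.2)
  have hab2 : t * a.1 + a.2 = t * b.1 + b.2 := by
    have := ha.2.trans hb.2.symm
    simpa [toPlane] using this
  have hlt' : (a.1 : ℝ) < b.1 := by exact_mod_cast hlt
  have hlt2 : b.2 < a.2 := by
    have : (b.2 : ℝ) < a.2 := by nlinarith
    exact_mod_cast this
  have hp0 : (0 : ℝ) < (b.1 - a.1 : ℕ) := by exact_mod_cast Nat.sub_pos_of_lt hlt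
  have hq : ((a.2 - b.2 : ℕ) : ℝ) = (b.1 - a.1 : ℕ) * t := by
    rw [Nat.cast_sub hlt2.le, Nat.cast_sub hlt.le]
    linarith
  have hw : ∀ x : ℝ × ℝ, ((a.2 - b.2 : ℕ) : ℝ) * x.1 + (b.1 - a.1 : ℕ) * x.2 =
      (b.1 - a.1 : ℕ) * weight t x := fun x => by
    rw [hq, weight_apply]
    ring
  have hwn : ∀ c : ℕ × ℕ, (((a.2 - b.2) * c.1 + (b.1 - a.1) * c.2 : ℕ) : ℝ) =
      (b.1 - a.1 : ℕ) * weight t (toPlane c) := fun c => by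
    rw [← hw]
    simp [toPlane]
  -- Height and length of the edge: the integral normal vector of the segment from `a` to `b`.
  refine ⟨a.2 - b.2, b.1 - a.1, (a.2 - b.2) * a.1 + (b.1 - a.1) * a.2, a, b,
    ⟨Nat.sub_pos_of_lt hlt2, Nat.sub_pos_of_lt hlt, ?_, hlt, ?_, ?_, ?_, rfl, ?_, ?_⟩⟩
  · ext x
    rw [hγ]
    simp only [face, Set.mem_ofPred_eq, huv, hw, mul_le_mul_iff_right₀ hv, mul_le_mul_iff_right₀ hp0]
  · intro T hT c hc
    have : (((a.2 - b.2) * a.1 + (b.1 - a.1) * a.2 : ℕ) : ℝ) ≤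
        ((a.2 - b.2) * c.1 + (b.1 - a.1) * c.2 : ℕ) := by
      rw [hwn, hwn, ha.2]
      exact mul_le_mul_of_nonneg_left (hmin _ (hT ▸ toPlane_mem_hullOf hc)) hp0.le
    exact_mod_cast this
  · refine hends (LinearMap.fst ℝ ℝ ℝ) a ha.1 ha.2 (fun x hx => (hbet x hx).1) fun c hc => ?_
    simpa [toPlane] using hc
  · refine hends (-LinearMap.fst ℝ ℝ ℝ) b hb.1 hb.2 (fun x hx => ?_) fun c hc => ?_
    · simpa [toPlane] using (hbet x hx).2
    · simpa [toPlane] using hc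
  · have : (((a.2 - b.2) * b.1 + (b.1 - a.1) * b.2 : ℕ) : ℝ) =
        ((a.2 - b.2) * a.1 + (b.1 - a.1) * a.2 : ℕ) := by
      rw [hwn, hwn, ha.2, hb.2]
    exact_mod_cast this
  · intro c hc
    have := hbet _ hc
    simpa [toPlane] using this

theorem IsEdgeWith.of_parallel {N γ : Set (ℝ × ℝ)} {q p M q' p' : ℕ} {a b : ℕ × ℕ}
    (h : IsEdgeWith N γ q p M a b) (hq' : 0 < q') (hp' : 0 < p') (hpar : q * p' = q' * p) :
    ∃ M', IsEdgeWith N γ q' p' M' a b := by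
  have hw : ∀ c : ℕ × ℕ, p * (q' * c.1 + p' * c.2) = p' * (q * c.1 + p * c.2) := fun c => by
    linear_combination c.1 * hpar.symm
  refine ⟨q' * a.1 + p' * a.2, hq', hp', ?_, h.lt, ?_, h.left_mem, h.right_mem, rfl, ?_,
    h.between⟩
  · rw [h.eq_face, face_eq_face h.p_pos hp' hpar]
  · intro T hT c hc
    refine Nat.le_of_mul_le_mul_left ?_ h.p_pos
    rw [hw, hw, h.left_eq]
    exact Nat.mul_le_mul_left _ (h.le T hT c hc)
  · refine Nat.eq_of_mul_eq_mul_left h.p_pos ?_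
    rw [hw, hw, h.left_eq, h.right_eq]

/-- Exponents on the two axes bound a box containing the ends of every compact edge, and the ends
determine the edge. -/
theorem finite_setOf_isCompactEdge {S : Set (ℕ × ℕ)} (hA : HasFiniteArea (hullOf S)) :
    {γ | IsCompactEdge (hullOf S) γ}.Finite := by
  obtain ⟨⟨l, hl⟩, k, hk⟩ := exists_mem_axes hA
  refine (((Set.finite_Iic (l, k)).prod (Set.finite_Iic (l, k))).image
    fun x : (ℕ × ℕ) × (ℕ × ℕ) => face (hullOf S) (x.1.2 - x.2.2) (x.2.1 - x.1.1)).subset ?_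
  intro γ hγ
  obtain ⟨q, p, M, a, b, h⟩ := exists_isEdgeWith hγ
  have hbox : ∀ c : ℕ × ℕ, q * c.1 + p * c.2 = M → c ≤ (l, k) := fun c hc => by
    have h1 := h.le S rfl _ hl
    have h2 := h.le S rfl _ hk
    simp only [mul_zero, add_zero, zero_add] at h1 h2
    exact ⟨Nat.le_of_mul_le_mul_left (show q * c.1 ≤ q * l by omega) h.q_pos,
      Nat.le_of_mul_le_mul_left (show p * c.2 ≤ p * k by omega) h.p_pos⟩
  refine ⟨(a, b), ⟨hbox a h.left_eq, hbox b h.right_eq⟩, ?_⟩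
  rw [h.eq_face]
  obtain ⟨e, he⟩ := Nat.exists_eq_add_of_lt h.lt
  have h1 := h.left_eq
  have h2 := h.right_eq
  have hle : b.2 ≤ a.2 := by
    refine Nat.le_of_mul_le_mul_left ?_ h.p_pos
    have : q * a.1 ≤ q * b.1 := Nat.mul_le_mul_left _ h.lt.le
    omega
  refine face_eq_face (Nat.sub_pos_of_lt h.lt) h.p_pos ?_
  zify [h.lt.le, hle] at h1 h2 ⊢
  linear_combination h1 - h2

/-! ### The openness of general position -/

open Classical in
/-- The lattice points on the edge `γ`, which lies on the line `q * x + p * y = M`. -/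
noncomputable def edgeIndex (γ : Set (ℝ × ℝ)) (q p M : ℕ) : Finset (ℕ × ℕ) :=
  (lineIndex M q p M).filter fun c => toPlane c ∈ γ

/-- The polynomial with coefficients `w` at the lattice points of an edge, divided by the power of
the variable at the left end point `a`. -/
noncomputable def strippedPoly {A : Type*} [CommSemiring A] (I : Finset (ℕ × ℕ)) (a : ℕ × ℕ)
    (w : ℕ × ℕ → A) : A[X] :=
  ∑ c ∈ I, Polynomial.monomial (c.1 - a.1) (w c)

theorem map_strippedPoly {A B : Type*} [CommSemiring A] [CommSemiring B] (f : A →+* B)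
    (I : Finset (ℕ × ℕ)) (a : ℕ × ℕ) (w : ℕ × ℕ → A) :
    (strippedPoly I a w).map f = strippedPoly I a (fun c => f (w c)) := by
  simp [strippedPoly, Polynomial.map_sum]

theorem strippedPoly_congr {A : Type*} [CommSemiring A] {I : Finset (ℕ × ℕ)} {a : ℕ × ℕ}
    {w w' : ℕ × ℕ → A} (h : ∀ c ∈ I, w c = w' c) : strippedPoly I a w = strippedPoly I a w' :=
  Finset.sum_congr rfl fun c hc => by rw [h c hc]

namespace IsEdgeWith

variable {N γ : Set (ℝ × ℝ)} {q p M : ℕ} {a b : ℕ × ℕ}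

open Classical in
theorem mem_edgeIndex (h : IsEdgeWith N γ q p M a b) {c : ℕ × ℕ} :
    c ∈ edgeIndex γ q p M ↔ q * c.1 + p * c.2 = M ∧ toPlane c ∈ γ := by
  rw [edgeIndex, Finset.mem_filter, mem_lineIndex h.p_pos]
  constructor
  · rintro ⟨⟨-, h1⟩, h2⟩
    exact ⟨h1, h2⟩
  · rintro ⟨h1, h2⟩
    have : c.1 ≤ q * c.1 := Nat.le_mul_of_pos_left _ h.q_pos
    exact ⟨⟨by omega, h1⟩, h2⟩

theorem mem_of_mem {T : Set (ℕ × ℕ)} (h : IsEdgeWith (hullOf T) γ q p M a b) {c : ℕ × ℕ}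
    (hc : c ∈ T) (hcM : q * c.1 + p * c.2 = M) : toPlane c ∈ γ := by
  rw [h.eq_face]
  exact toPlane_mem_face h.p_pos (h.le T rfl) hc hcM

theorem left_mem_edgeIndex {T : Set (ℕ × ℕ)} (h : IsEdgeWith (hullOf T) γ q p M a b) :
    a ∈ edgeIndex γ q p M :=
  h.mem_edgeIndex.2 ⟨h.left_eq, h.mem_of_mem (h.left_mem T rfl) h.left_eq⟩

theorem right_mem_edgeIndex {T : Set (ℕ × ℕ)} (h : IsEdgeWith (hullOf T) γ q p M a b) :
    b ∈ edgeIndex γ q p M :=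
  h.mem_edgeIndex.2 ⟨h.right_eq, h.mem_of_mem (h.right_mem T rfl) h.right_eq⟩

theorem natDegree_strippedPoly_le (h : IsEdgeWith N γ q p M a b) {A : Type*} [CommSemiring A]
    (w : ℕ × ℕ → A) : (strippedPoly (edgeIndex γ q p M) a w).natDegree ≤ b.1 - a.1 :=
  Polynomial.natDegree_sum_le_of_forall_le _ _ fun c hc =>
    (Polynomial.natDegree_monomial_le _).trans
      (Nat.sub_le_sub_right (h.between c (h.mem_edgeIndex.1 hc).2).2 _)

theorem coeff_strippedPoly (h : IsEdgeWith N γ q p M a b) {A : Type*} [CommSemiring A]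
    (w : ℕ × ℕ → A) {c : ℕ × ℕ} (hc : c ∈ edgeIndex γ q p M) :
    (strippedPoly (edgeIndex γ q p M) a w).coeff (c.1 - a.1) = w c := by
  rw [strippedPoly, Polynomial.finsetSum_coeff, Finset.sum_eq_single_of_mem c hc]
  · simp
  · intro d hd hdc
    rw [Polynomial.coeff_monomial, if_neg]
    intro hdc'
    obtain ⟨hc1, hc2⟩ := h.mem_edgeIndex.1 hc
    obtain ⟨hd1, hd2⟩ := h.mem_edgeIndex.1 hd
    have h1 := (h.between c hc2).1
    have h2 := (h.between d hd2).1
    have h3 : d.1 = c.1 := by omega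
    refine hdc (Prod.ext h3 (Nat.eq_of_mul_eq_mul_left h.p_pos ?_))
    rw [h3] at hd1
    omega

theorem natDegree_strippedPoly {T : Set (ℕ × ℕ)} (h : IsEdgeWith (hullOf T) γ q p M a b)
    {A : Type*} [CommSemiring A] {w : ℕ × ℕ → A} (hw : w b ≠ 0) :
    (strippedPoly (edgeIndex γ q p M) a w).natDegree = b.1 - a.1 := by
  refine le_antisymm (h.natDegree_strippedPoly_le w) (Polynomial.le_natDegree_of_ne_zero ?_)
  rwa [h.coeff_strippedPoly w h.right_mem_edgeIndex]

theorem strippedPoly_ne_zero {T : Set (ℕ × ℕ)} (h : IsEdgeWith (hullOf T) γ q p M a b)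
    {A : Type*} [CommSemiring A] {w : ℕ × ℕ → A} (hw : w b ≠ 0) :
    strippedPoly (edgeIndex γ q p M) a w ≠ 0 := fun h0 => hw <| by
  rw [← h.coeff_strippedPoly w h.right_mem_edgeIndex, h0, Polynomial.coeff_zero]

theorem not_isRoot_zero_strippedPoly {T : Set (ℕ × ℕ)} (h : IsEdgeWith (hullOf T) γ q p M a b)
    {w : ℕ × ℕ → ℂ} (hw : w a ≠ 0) : ¬ (strippedPoly (edgeIndex γ q p M) a w).IsRoot 0 := by
  have := h.coeff_strippedPoly w h.left_mem_edgeIndex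
  rw [Nat.sub_self, Polynomial.coeff_zero_eq_eval_zero] at this
  rwa [Polynomial.IsRoot, this]

theorem eval_strippedPoly_ite {T : Set (ℕ × ℕ)} (h : IsEdgeWith (hullOf T) γ q p M a b) (s c : ℂ) :
    (strippedPoly (edgeIndex γ q p M) a fun d => if d = b then 1 else if d = a then s else 0).eval c =
      s + c ^ (b.1 - a.1) := by
  have hab : a ≠ b := fun hab => h.lt.ne (congrArg Prod.fst hab)
  rw [strippedPoly, Polynomial.eval_finsetSum, Finset.sum_eq_add_of_mem a b h.left_mem_edgeIndex
    h.right_mem_edgeIndex hab]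
  · simp [hab]
  · rintro d - ⟨hda, hdb⟩
    simp [hda, hdb]

theorem linePoly_eq {P : Cz[X]} (h : IsEdgeWith (newtonPolygon P) γ q p M a b) :
    linePoly P M q p M = Polynomial.X ^ a.1 *
      strippedPoly (edgeIndex γ q p M) a fun c => coeffAt P c.1 c.2 := by
  classical
  have hsub : edgeIndex γ q p M ⊆ lineIndex M q p M := Finset.filter_subset _ _
  rw [linePoly, strippedPoly, Finset.mul_sum, ← Finset.sum_subset hsub]
  · refine Finset.sum_congr rfl fun c hc => ?_
    have := (h.between c (h.mem_edgeIndex.1 hc).2).1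
    rw [Polynomial.X_pow_mul_monomial, Nat.sub_add_cancel this]
  · intro c hc hc'
    by_contra h0
    have hcM := ((mem_lineIndex h.p_pos).1 hc).2
    refine hc' (h.mem_edgeIndex.2 ⟨hcM, h.mem_of_mem (T := exponents P) ?_ hcM⟩)
    exact fun h1 => h0 (by rw [h1, Polynomial.monomial_zero_right])

theorem isRoot_linePoly {P : Cz[X]} (h : IsEdgeWith (newtonPolygon P) γ q p M a b) {c : ℂ}
    (hc : c ≠ 0) : (linePoly P M q p M).IsRoot c ↔
      (strippedPoly (edgeIndex γ q p M) a fun c => coeffAt P c.1 c.2).IsRoot c := by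
  rw [h.linePoly_eq, Polynomial.IsRoot, Polynomial.eval_mul, Polynomial.eval_pow, Polynomial.eval_X,
    mul_eq_zero, or_iff_right (pow_ne_zero _ hc), Polynomial.IsRoot]

theorem fst_le {P : Cz[X]} (h : IsEdgeWith N γ q p M a b) :
    ∀ c ∈ exponents P, q * c.1 + p * c.2 = M → c.1 ≤ M := fun c _ hc => by
  have : c.1 ≤ q * c.1 := Nat.le_mul_of_pos_left _ h.q_pos
  omega

theorem evalEval_edgePolynomial {P : Cz[X]} (h : IsEdgeWith (newtonPolygon P) γ q p M a b)
    (c τ : ℂ) : (edgePolynomial P γ).evalEval (τ ^ p) (c * τ ^ q) =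
      τ ^ M * (linePoly P M q p M).eval c := by
  rw [h.eq_face]
  exact evalEval_edgePolynomial_face h.p_pos (h.le _ rfl) ⟨a, h.left_mem _ rfl, h.left_eq⟩ h.fst_le
    c τ

/-- Near the origin, the zeros of an edge polynomial off the axes are of prescribed order. -/
theorem exists_abs_log_sub_le {P : Cz[X]} (h : IsEdgeWith (newtonPolygon P) γ q p M a b) :
    ∃ C : ℝ, ∀ z : ℂ × ℂ, z.1 ≠ 0 → z.2 ≠ 0 → (edgePolynomial P γ).evalEval z.1 z.2 = 0 →
      |p * Real.log ‖z.2‖ - q * Real.log ‖z.1‖| ≤ C := by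
  have h0 : linePoly P M q p M ≠ 0 := by
    rw [h.linePoly_eq]
    exact mul_ne_zero (pow_ne_zero _ Polynomial.X_ne_zero)
      (h.strippedPoly_ne_zero (T := exponents P) (h.right_mem _ rfl))
  refine ⟨∑ c ∈ (linePoly P M q p M).roots.toFinset, |p * Real.log ‖c‖|, fun z hz1 hz2 hz => ?_⟩
  obtain ⟨τ, hτ⟩ := IsAlgClosed.exists_pow_nat_eq z.1 h.p_pos
  have hτ0 : τ ≠ 0 := by
    rintro rfl
    exact hz1 (by rw [← hτ, zero_pow h.p_pos.ne'])
  set c := z.2 / τ ^ q with hc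
  have hz2' : z.2 = c * τ ^ q := (div_mul_cancel₀ _ (pow_ne_zero _ hτ0)).symm
  have hc0 : c ≠ 0 := div_ne_zero hz2 (pow_ne_zero _ hτ0)
  rw [← hτ, hz2', h.evalEval_edgePolynomial] at hz
  have hroot := (mul_eq_zero.1 hz).resolve_left (pow_ne_zero _ hτ0)
  have heq : p * Real.log ‖z.2‖ - q * Real.log ‖z.1‖ = p * Real.log ‖c‖ := by
    rw [hz2', ← hτ, norm_mul, norm_pow, norm_pow, Real.log_mul (norm_ne_zero_iff.2 hc0)
      (pow_ne_zero _ (norm_ne_zero_iff.2 hτ0)), Real.log_pow, Real.log_pow]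
    ring
  rw [heq]
  refine Finset.single_le_sum (f := fun c : ℂ => |p * Real.log ‖c‖|) (fun _ _ => abs_nonneg _) ?_
  rw [Multiset.mem_toFinset, Polynomial.mem_roots h0]
  exact hroot

end IsEdgeWith

/-- Eliminating $\log|z_2|$ from the two bounds of `exists_abs_log_sub_le` bounds
$(qp'-q'p)\log|z_1|$. The integer factor is nonzero, so $z_1$ stays away from 0. -/
theorem eventually_not_common_zero_of_not_parallel {γ γ' : Set (ℝ × ℝ)} {q p M q' p' M' : ℕ}
    {a b a' b' : ℕ × ℕ} {P Q : Cz[X]} (h : IsEdgeWith (newtonPolygon P) γ q p M a b)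
    (h' : IsEdgeWith (newtonPolygon Q) γ' q' p' M' a' b') (hne : q * p' ≠ q' * p) :
    ∀ᶠ z : ℂ × ℂ in 𝓝 0, z.1 ≠ 0 → z.2 ≠ 0 →
      ¬ ((edgePolynomial P γ).evalEval z.1 z.2 = 0 ∧
        (edgePolynomial Q γ').evalEval z.1 z.2 = 0) := by
  obtain ⟨C, hC⟩ := h.exists_abs_log_sub_le
  obtain ⟨C', hC'⟩ := h'.exists_abs_log_sub_le
  have hcont : Continuous fun z : ℂ × ℂ => ‖z.1‖ := by fun_prop
  have hev : ∀ᶠ z : ℂ × ℂ in 𝓝 0, ‖z.1‖ < Real.exp (-(p' * C + p * C')) :=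
    hcont.continuousAt.eventually_lt continuousAt_const (by simpa using Real.exp_pos _)
  filter_upwards [hev] with z hz hz1 hz2 ⟨h1, h2⟩
  have e1 := hC z hz1 hz2 h1
  have e2 := hC' z hz1 hz2 h2
  have hlog : Real.log ‖z.1‖ < -(p' * C + p * C') :=
    (Real.log_lt_iff_lt_exp (norm_pos_iff.2 hz1)).2 hz
  have hint : (1 : ℝ) ≤ |(q : ℝ) * p' - q' * p| := by
    have : (1 : ℤ) ≤ |(q : ℤ) * p' - q' * p| :=
      Int.one_le_abs (sub_ne_zero.2 (by exact_mod_cast hne))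
    exact_mod_cast this
  have key : ((q : ℝ) * p' - q' * p) * Real.log ‖z.1‖ =
      p * (p' * Real.log ‖z.2‖ - q' * Real.log ‖z.1‖) -
      p' * (p * Real.log ‖z.2‖ - q * Real.log ‖z.1‖) := by ring
  have hle : |((q : ℝ) * p' - q' * p) * Real.log ‖z.1‖| ≤ p * C' + p' * C := by
    rw [key]
    refine (abs_sub _ _).trans ?_
    rw [abs_mul, abs_mul, Nat.abs_cast, Nat.abs_cast]
    gcongr
  rw [abs_mul] at hle
  have h3 : |Real.log ‖z.1‖| ≤ |(q : ℝ) * p' - q' * p| * |Real.log ‖z.1‖| :=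
    le_mul_of_one_le_left (abs_nonneg _) hint
  have h4 := neg_le_abs (Real.log ‖z.1‖)
  linarith

theorem resultant_ne_zero_iff {f g : ℂ[X]} {m n : ℕ} (hf : f ≠ 0) (hm : f.natDegree = m)
    (hn : g.natDegree = n) :
    Polynomial.resultant f g m n ≠ 0 ↔ ∀ c, f.IsRoot c → ¬ g.IsRoot c := by
  subst hm hn
  rw [Ne, Polynomial.resultant_eq_zero_iff, not_and, not_not,
    Polynomial.isCoprime_iff_aeval_ne_zero_of_isAlgClosed ℂ ℂ]
  simp only [hf, ne_eq, not_false_eq_true, true_or, forall_const, Polynomial.IsRoot,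
    Polynomial.coe_aeval_eq_eval]
  exact forall_congr' fun c => imp_iff_not_or.symm

open Classical in
/-- For a single pair of edges, general position is the non-vanishing of a polynomial. -/
theorem exists_mvPolynomial_of_edges {S T : Set (ℕ × ℕ)} {γ γ' : Set (ℝ × ℝ)}
    (hγ : IsCompactEdge (hullOf S) γ) (hγ' : IsCompactEdge (hullOf T) γ') :
    ∃ F : MvPolynomial (EdgePoint (hullOf S) ⊕ EdgePoint (hullOf T)) ℂ, F ≠ 0 ∧
      ∀ P Q : Cz[X], newtonPolygon P = hullOf S → newtonPolygon Q = hullOf T →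
        ((∀ᶠ z : ℂ × ℂ in 𝓝 0, z.1 ≠ 0 → z.2 ≠ 0 →
          ¬ ((edgePolynomial P γ).evalEval z.1 z.2 = 0 ∧
            (edgePolynomial Q γ').evalEval z.1 z.2 = 0)) ↔
        MvPolynomial.eval (edgeCoeffs (hullOf S) (hullOf T) P Q) F ≠ 0) := by
  obtain ⟨q, p, M, a, b, h⟩ := exists_isEdgeWith hγ
  obtain ⟨q', p', M₀, a', b', h₀⟩ := exists_isEdgeWith hγ'
  by_cases hpar : q * p' = q' * p
  swap
  · refine ⟨1, one_ne_zero, fun P Q hP hQ => ?_⟩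
    simp only [map_one, ne_eq, one_ne_zero, not_false_eq_true, iff_true]
    exact eventually_not_common_zero_of_not_parallel (hP.symm ▸ h) (hQ.symm ▸ h₀) hpar
  obtain ⟨M', h'⟩ := h₀.of_parallel h.q_pos h.p_pos hpar.symm
  let W : ℕ × ℕ → MvPolynomial (EdgePoint (hullOf S) ⊕ EdgePoint (hullOf T)) ℂ := fun c =>
    if hc : ∃ γ, IsCompactEdge (hullOf S) γ ∧ toPlane c ∈ γ then MvPolynomial.X (Sum.inl ⟨c, hc⟩)
    else 0
  let W' : ℕ × ℕ → MvPolynomial (EdgePoint (hullOf S) ⊕ EdgePoint (hullOf T)) ℂ := fun c =>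
    if hc : ∃ γ, IsCompactEdge (hullOf T) γ ∧ toPlane c ∈ γ then MvPolynomial.X (Sum.inr ⟨c, hc⟩)
    else 0
  have hW : ∀ x y : ℕ × ℕ → ℂ, ∀ c ∈ edgeIndex γ q p M,
      MvPolynomial.eval (Sum.elim (fun e => x e.1) (fun e => y e.1)) (W c) = x c := by
    intro x y c hc
    have hc' : ∃ γ, IsCompactEdge (hullOf S) γ ∧ toPlane c ∈ γ := ⟨γ, hγ, (h.mem_edgeIndex.1 hc).2⟩
    simp only [W, dif_pos hc', MvPolynomial.eval_X]
    rfl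
  have hW' : ∀ x y : ℕ × ℕ → ℂ, ∀ c ∈ edgeIndex γ' q p M',
      MvPolynomial.eval (Sum.elim (fun e => x e.1) (fun e => y e.1)) (W' c) = y c := by
    intro x y c hc
    have hc' : ∃ γ, IsCompactEdge (hullOf T) γ ∧ toPlane c ∈ γ :=
      ⟨γ', hγ', (h'.mem_edgeIndex.1 hc).2⟩
    simp only [W', dif_pos hc', MvPolynomial.eval_X]
    rfl
  -- The resultant of generic polynomials with prescribed degrees commutes with specialization;
  -- these are the true degrees once the right end coefficients are nonzero.
  set F := Polynomial.resultant (strippedPoly (edgeIndex γ q p M) a W)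
    (strippedPoly (edgeIndex γ' q p M') a' W') (b.1 - a.1) (b'.1 - a'.1) with hF
  have hFeval : ∀ x y : ℕ × ℕ → ℂ, x b ≠ 0 → y b' ≠ 0 →
      (MvPolynomial.eval (Sum.elim (fun e => x e.1) (fun e => y e.1)) F ≠ 0 ↔
        ∀ c, (strippedPoly (edgeIndex γ q p M) a x).IsRoot c →
          ¬ (strippedPoly (edgeIndex γ' q p M') a' y).IsRoot c) := by
    intro x y hx hy
    rw [hF, ← Polynomial.resultant_map_map, map_strippedPoly, map_strippedPoly,
      strippedPoly_congr (hW x y), strippedPoly_congr (hW' x y)]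
    exact resultant_ne_zero_iff (h.strippedPoly_ne_zero hx) (h.natDegree_strippedPoly hx)
      (h'.natDegree_strippedPoly hy)
  refine ⟨F, ?_, fun P Q hP hQ => ?_⟩
  -- The test polynomials $X^n-1$ and $X^{n'}-2$ have no common root, since the absolute values of
  -- their roots differ.
  · let x : ℕ × ℕ → ℂ := fun c => if c = b then 1 else if c = a then -1 else 0
    let y : ℕ × ℕ → ℂ := fun c => if c = b' then 1 else if c = a' then -2 else 0
    have hx : x b ≠ 0 := by simp [x]
    have hy : y b' ≠ 0 := by simp [y]
    intro hF0
    refine (hFeval x y hx hy).2 ?_ (by rw [hF0, map_zero])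
    intro c h1 h2
    rw [Polynomial.IsRoot, h.eval_strippedPoly_ite, neg_add_eq_zero] at h1
    rw [Polynomial.IsRoot, h'.eval_strippedPoly_ite, neg_add_eq_zero] at h2
    have hn1 : ‖c‖ = 1 := by
      refine (pow_eq_one_iff_of_nonneg (norm_nonneg c) (Nat.sub_pos_of_lt h.lt).ne').1 ?_
      rw [← norm_pow, ← h1, norm_one]
    have hn2 := congrArg norm h2
    rw [norm_pow, hn1, one_pow] at hn2
    norm_num at hn2
  · have e1 : IsEdgeWith (newtonPolygon P) γ q p M a b := hP.symm ▸ h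
    have e2 : IsEdgeWith (newtonPolygon Q) γ' q p M' a' b' := hQ.symm ▸ h'
    have hev := hFeval (fun c => coeffAt P c.1 c.2) (fun c => coeffAt Q c.1 c.2)
      (e1.right_mem (exponents P) rfl) (e2.right_mem (exponents Q) rfl)
    rw [show edgeCoeffs (hullOf S) (hullOf T) P Q = _ from rfl]
    refine Iff.trans ?_ hev.symm
    have hiff := eventually_not_common_zero_iff h.q_pos h.p_pos (e1.le (exponents P) rfl)
      ⟨a, e1.left_mem _ rfl, e1.left_eq⟩ e1.fst_le (e2.le (exponents Q) rfl)
      ⟨a', e2.left_mem _ rfl, e2.left_eq⟩ e2.fst_le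
    rw [← e1.eq_face, ← e2.eq_face] at hiff
    rw [hiff]
    constructor
    · intro H c h1 h2
      -- The coefficient at the left end is nonzero, so 0 is not a root after stripping.
      have hc : c ≠ 0 := by
        rintro rfl
        exact e1.not_isRoot_zero_strippedPoly (T := exponents P)
          (w := fun c => coeffAt P c.1 c.2) (e1.left_mem (exponents P) rfl) h1
      exact hc (H c ((e1.isRoot_linePoly hc).2 h1) ((e2.isRoot_linePoly hc).2 h2))
    · intro H c h1 h2
      by_contra hc
      exact H c ((e1.isRoot_linePoly hc).1 h1) ((e2.isRoot_linePoly hc).1 h2)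

/-- General position is a conjunction over pairs of edges, finitely many by finite area, so the
product of the polynomials of the pairs works; it is nonzero because the polynomial ring is a
domain. -/
theorem exists_mvPolynomial {S T : Set (ℕ × ℕ)} (hS : HasFiniteArea (hullOf S))
    (hT : HasFiniteArea (hullOf T)) :
    ∃ F : MvPolynomial (EdgePoint (hullOf S) ⊕ EdgePoint (hullOf T)) ℂ, F ≠ 0 ∧
      ∀ P Q : Cz[X], newtonPolygon P = hullOf S → newtonPolygon Q = hullOf T →
        (EdgesInGeneralPosition (hullOf S) (hullOf T) P Q ↔
        MvPolynomial.eval (edgeCoeffs (hullOf S) (hullOf T) P Q) F ≠ 0) := by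
  choose F hF0 hF using fun (γ : {γ // IsCompactEdge (hullOf S) γ})
    (γ' : {γ // IsCompactEdge (hullOf T) γ}) => exists_mvPolynomial_of_edges γ.2 γ'.2
  have := (finite_setOf_isCompactEdge hS).fintype
  have := (finite_setOf_isCompactEdge hT).fintype
  refine ⟨∏ γ : {γ | IsCompactEdge (hullOf S) γ}, ∏ γ' : {γ | IsCompactEdge (hullOf T) γ}, F γ γ',
    ?_, fun P Q hP hQ => ?_⟩
  · exact Finset.prod_ne_zero_iff.2 fun γ _ => Finset.prod_ne_zero_iff.2 fun γ' _ => hF0 γ γ'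
  · rw [map_prod, Finset.prod_ne_zero_iff]
    simp only [map_prod, Finset.prod_ne_zero_iff, Finset.mem_univ, forall_const]
    constructor
    · intro H γ γ'
      exact (hF γ γ' P Q hP hQ).1 (H _ _ γ.2 γ'.2)
    · intro H γ γ' hγ hγ'
      exact (hF ⟨γ, hγ⟩ ⟨γ', hγ'⟩ P Q hP hQ).2 (H ⟨γ, hγ⟩ ⟨γ', hγ'⟩)

end NewtonProduct

theorem mainTheorem9 (N₁ N₂ : Set (ℝ × ℝ))
    (hN₁ : NewtonProduct.IsNewtonPolygon N₁) (hN₂ : NewtonProduct.IsNewtonPolygon N₂)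
    (hA₁ : NewtonProduct.HasFiniteArea N₁) (hA₂ : NewtonProduct.HasFiniteArea N₂) :
    (∀ P₁ P₂ : NewtonProduct.Cz[X], P₁.Monic → P₂.Monic →
      NewtonProduct.newtonPolygon P₁ = N₁ → NewtonProduct.newtonPolygon P₂ = N₂ →
      (∀ c : ℂ, (NewtonProduct.atZero P₁).IsRoot c → (NewtonProduct.atZero P₂).IsRoot c → c = 0) →
      NewtonProduct.EdgesInGeneralPosition N₁ N₂ P₁ P₂ →
      NewtonProduct.newtonPolygon (NewtonProduct.resultantPoly P₁ P₂) =
        NewtonProduct.polygonMul N₁ N₂) ∧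
    (∃ F : MvPolynomial (NewtonProduct.EdgePoint N₁ ⊕ NewtonProduct.EdgePoint N₂) ℂ, F ≠ 0 ∧
      ∀ P₁ P₂ : NewtonProduct.Cz[X],
        NewtonProduct.newtonPolygon P₁ = N₁ → NewtonProduct.newtonPolygon P₂ = N₂ →
        (NewtonProduct.EdgesInGeneralPosition N₁ N₂ P₁ P₂ ↔
          MvPolynomial.eval (NewtonProduct.edgeCoeffs N₁ N₂ P₁ P₂) F ≠ 0)) := by
  constructor
  · rintro P₁ P₂ hP₁ hP₂ rfl rfl h0 hE
    exact NewtonProduct.newtonPolygon_resultantPoly hP₁ hP₂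
      (NewtonProduct.exists_mem_axes hA₁).2 (NewtonProduct.exists_mem_axes hA₂).2 h0 hE
  · obtain ⟨S, -, rfl⟩ := hN₁
    obtain ⟨T, -, rfl⟩ := hN₂
    exact NewtonProduct.exists_mvPolynomial hA₁ hA₂
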